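/- Let $\Bbbk$ be an algebraically closed field of characteristic zero and let $N\ge 1$. Let $V$ be a superspace over $\Bbbk$ with an ordered homogeneous basis $v_1,\dots,v_{N+1}$, and let $\bar k\in\mathbb Z/2$ be the parity of $v_k$. Put $I=\{1,\dots,N\}$. On $\bigoplus_{k=1}^{N+1}\mathbb Z\epsilon_k$ take the bilinear form $(\epsilon_k,\epsilon_l)=\delta_{kl}(-1)^{\bar k}$. For $i,j\in I$ let $\alpha_i=\epsilon_i-\epsilon_{i+1}$, $c_{ij}=(\alpha_i,\alpha_j)$ and $|\alpha_i|=\bar i+\overline{i+1}\in\mathbb Z/2$. The vertex $i$ is even or odd according to $|\alpha_i|$, and the neighbours of $i$ are the $j\in I$ with $j=i\pm1$. For homogeneous elements of a superalgebra write $[x,y]=xy-(-1)^{|x||y|}yx$ and $\{x,y\}=xy+(-1)^{|x||y|}yx$. The Drinfeld super Yangian $Y_\hbar(\mathfrak{sl}(V))$ is the unital associative $\Bbbk[[\hbar]]$-superalgebra generated by $h_{ir},x^{\pm}_{ir}$ ($i\in I$, $r\in\mathbb Z_{\ge0}$), with parities $|h_{ir}|=\bar0$ and $|x^\pm_{ir}|=|\alpha_i|$,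 subject to the following relations for all $i,j\in I$ and $r,s,t\ge 0$: \begin{itemize} \item $[h_{ir},h_{js}]=0$; \item $[h_{i0},x^\pm_{js}]=\pm c_{ij}x^\pm_{js}$; \item $[x^+_{ir},x^-_{js}]=\delta_{ij}h_{i,r+s}$; \item $[h_{i,r+1},x^\pm_{js}]-[h_{ir},x^\pm_{j,s+1}]=\pm\frac{c_{ij}\hbar}{2}\{h_{ir},x^\pm_{js}\}$ unless $i=j$ and $|\alpha_i|=\bar1$; \item $[x^\pm_{i,r+1},x^\pm_{js}]-[x^\pm_{ir},x^\pm_{j,s+1}]=\pm\frac{c_{ij}\hbar}{2}\{x^\pm_{ir},x^\pm_{js}\}$ unless $i=j$ and $|\alpha_i|=\bar1$; \item $[h_{ir},x^\pm_{is}]=0$ if $|\alpha_i|=\bar1$; \item $[x^\pm_{ir},x^\pm_{js}]=0$ if $c_{ij}=0$; \item $[x^\pm_{ir},[x^\pm_{is},x^\pm_{jt}]]+[x^\pm_{is},[x^\pm_{ir},x^\pm_{jt}]]=0$ if $|i-j|=1$ and $|\alpha_i|=\bar0$; \item $[[x^\pm_{j-1,r},x^\pm_{j0}],[x^\pm_{j0},x^\pm_{j+1,s}]]=0$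 if $j-1,j,j+1\in I$ and $|\alpha_j|=\bar1$. \end{itemize} Assume that $N\ne1$, that it is not the case that $N=3$ and $|\alpha_1|=|\alpha_3|$, and that every odd vertex has at least one even neighbour. Then $Y_\hbar(\mathfrak{sl}(V))$ is isomorphic, as a $\Bbbk[[\hbar]]$-superalgebra, to the superalgebra generated by $h_{ir},x^\pm_{ir}$ ($i\in I$, $r\in\{0,1\}$), with parities $|h_{ir}|=\bar0$ and $|x^\pm_{ir}|=|\alpha_i|$, subject only to the following relations for all $i,j\in I$, where $\widetilde h_{i1}=h_{i1}-\frac{\hbar}{2}h_{i0}^2$: \begin{enumerate} \item $[h_{ir},h_{js}]=0$ for $0\le r,s\le1$; \item $[h_{i0},x^\pm_{js}]=\pm c_{ij}x^\pm_{js}$ for $s=0,1$; \item $[x^+_{ir},x^-_{js}]=\delta_{ij}h_{i,r+s}$ for $0\le r+s\le1$; \item $[\widetilde h_{i1},x^\pm_{j0}]=\pm c_{ij}x^\pm_{j1}$ unless $i=j$ and $|\alpha_i|=\bar1$; \item $[x^\pm_{i1},x^\pm_{j0}]-[x^\pm_{i0},x^\pm_{j1}]=\pm\frac{c_{ij}\hbar}{2}\{x^\pm_{i0},x^\pm_{j0}\}$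 unless $i=j$ and $|\alpha_i|=\bar1$; \item $[h_{i1},x^\pm_{is}]=0$ for $s=0,1$ if $|\alpha_i|=\bar1$; \item $[x^\pm_{i0},x^\pm_{j0}]=0$ if $c_{ij}=0$; \item $[x^\pm_{i0},[x^\pm_{i0},x^\pm_{j0}]]=0$ if $|i-j|=1$ and $|\alpha_i|=\bar0$; \item $[[x^\pm_{j-1,0},x^\pm_{j0}],[x^\pm_{j0},x^\pm_{j+1,0}]]=0$ if $j-1,j,j+1\in I$ and $|\alpha_j|=\bar1$. \end{enumerate} The isomorphism may be chosen to preserve parity and to send each generator $h_{ir}$, $x^\pm_{ir}$ with $r\in\{0,1\}$ to the generator of $Y_\hbar(\mathfrak{sl}(V))$ of the same name. -/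

import Mathlib

noncomputable section

/-! ### Superalgebras given by generators and homogeneous relations -/

namespace SuperPresentation

/-- The sign `(-1)^a` for `a ∈ ℤ/2`. -/
def sgn (a : ZMod 2) : ℤ := if a = 0 then 1 else -1

section

variable (R : Type*) [CommRing R] {G : Type*} (par : G → ZMod 2)

/-- The parity-`a` part of the free superalgebra on generators `g` of parity `par g`:
the span of the words whose letters have total parity `a`. -/
def freeGrading (a : ZMod 2) : Submodule R (FreeAlgebra R G) :=
  Submodule.span R
    {w | ∃ l : List G, (l.map par).sum = a ∧ (l.map (FreeAlgebra.ι R)).prod = w}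

instance freeGrading_gradedMonoid : SetLike.GradedMonoid (freeGrading R par) where
  one_mem := Submodule.subset_span ⟨[], by simp⟩
  mul_mem := by
    intro a b x y hx hy
    have h := Submodule.mul_mem_mul hx hy
    rw [freeGrading, freeGrading, Submodule.span_mul_span] at h
    refine Submodule.span_mono ?_ h
    rintro _ ⟨_, ⟨l, hl, rfl⟩, _, ⟨l', hl', rfl⟩, rfl⟩
    exact ⟨l ++ l', by simp [hl, hl']⟩

lemma ι_mem_freeGrading (g : G) : FreeAlgebra.ι R g ∈ freeGrading R par (par g) :=
  Submodule.subset_span ⟨[g], by simp⟩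

/-- A homogeneous element of the free superalgebra, together with its parity. -/
structure Homog where
  /-- the parity `|x|` -/
  deg : ZMod 2
  /-- the underlying element `x` -/
  val : FreeAlgebra R G
  mem : val ∈ freeGrading R par deg

namespace Homog

variable {R par}

/-- The super commutator `[x, y] = x y - (-1)^{|x||y|} y x`, of parity `|x| + |y|`. -/
def comm (x y : Homog R par) : Homog R par where
  deg := x.deg + y.deg
  val := x.val * y.val - sgn (x.deg * y.deg) • (y.val * x.val)
  mem := by
    refine sub_mem (SetLike.mul_mem_graded x.mem y.mem) (zsmul_mem ?_ _)
    rw [add_comm]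
    exact SetLike.mul_mem_graded y.mem x.mem

/-- The super anticommutator `{x, y} = x y + (-1)^{|x||y|} y x`, of parity `|x| + |y|`. -/
def anti (x y : Homog R par) : Homog R par where
  deg := x.deg + y.deg
  val := x.val * y.val + sgn (x.deg * y.deg) • (y.val * x.val)
  mem := by
    refine add_mem (SetLike.mul_mem_graded x.mem y.mem) (zsmul_mem ?_ _)
    rw [add_comm]
    exact SetLike.mul_mem_graded y.mem x.mem

end Homog

variable (rel : FreeAlgebra R G → FreeAlgebra R G → Prop)

/-- The parity-`a` part of the superalgebra with generators `G` and relations `rel`. -/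
def grading (a : ZMod 2) : Submodule R (RingQuot rel) :=
  (freeGrading R par a).map (RingQuot.mkAlgHom R rel).toLinearMap

instance grading_gradedMonoid : SetLike.GradedMonoid (grading R par rel) where
  one_mem := ⟨1, SetLike.one_mem_graded (freeGrading R par), map_one (RingQuot.mkAlgHom R rel)⟩
  mul_mem := by
    rintro a b _ _ ⟨x, hx, rfl⟩ ⟨y, hy, rfl⟩
    exact ⟨x * y, SetLike.mul_mem_graded hx hy, map_mul (RingQuot.mkAlgHom R rel) x y⟩

/-- The algebra map splitting an element of the free algebra into its parity components in
the quotient. -/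
def splitFree : FreeAlgebra R G →ₐ[R] DirectSum (ZMod 2) fun a => grading R par rel a :=
  FreeAlgebra.lift R fun g =>
    DirectSum.of (fun a => grading R par rel a) (par g)
      ⟨RingQuot.mkAlgHom R rel (FreeAlgebra.ι R g), _, ι_mem_freeGrading R par g, rfl⟩

lemma coe_splitFree (x : FreeAlgebra R G) :
    DirectSum.coeAlgHom (grading R par rel) (splitFree R par rel x) =
      RingQuot.mkAlgHom R rel x := by
  have : (DirectSum.coeAlgHom (grading R par rel)).comp (splitFree R par rel) =
      RingQuot.mkAlgHom R rel := by
    ext g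
    simp [splitFree]
  exact DFunLike.congr_fun this x

lemma splitFree_mem {a : ZMod 2} {x : FreeAlgebra R G} (hx : x ∈ freeGrading R par a) :
    splitFree R par rel x =
      DirectSum.lof R (ZMod 2) (fun a => grading R par rel a) a
        ⟨RingQuot.mkAlgHom R rel x, x, hx, rfl⟩ := by
  have key : splitFree R par rel x ∈
      LinearMap.range (DirectSum.lof R (ZMod 2) (fun a => grading R par rel a) a) := by
    have hle : freeGrading R par a ≤ (LinearMap.range
        (DirectSum.lof R (ZMod 2) (fun a => grading R par rel a) a)).comap
        (splitFree R par rel).toLinearMap := by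
      refine Submodule.span_le.2 ?_
      rintro _ ⟨l, rfl, rfl⟩
      clear hx
      induction l with
      | nil =>
        exact ⟨GradedMonoid.GOne.one (A := fun a => grading R par rel a),
          (map_one (splitFree R par rel)).symm⟩
      | cons g l ih =>
        obtain ⟨y, hy⟩ := ih
        refine ⟨GradedMonoid.GMul.mul (A := fun a => grading R par rel a)
          ⟨RingQuot.mkAlgHom R rel (FreeAlgebra.ι R g), _, ι_mem_freeGrading R par g, rfl⟩ y, ?_⟩
        simp only [AlgHom.toLinearMap_apply, List.map_cons, List.prod_cons, map_mul] at hy ⊢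
        rw [← hy, splitFree, FreeAlgebra.lift_ι_apply]
        exact (DirectSum.of_mul_of _ _).symm
    exact hle hx
  obtain ⟨y, hy⟩ := key
  rw [← hy]
  congr 1
  ext
  have h := coe_splitFree R par rel x
  rw [← hy, DirectSum.lof_eq_of, DirectSum.coeAlgHom_of] at h
  exact h

/-- If every relation equates two elements of the same parity, the quotient is a superalgebra,
that is, a `ℤ/2`-graded algebra. -/
@[reducible] def gradedAlgebra
    (hrel : ∀ x y, rel x y → ∃ a, x ∈ freeGrading R par a ∧ y ∈ freeGrading R par a) :
    GradedAlgebra (grading R par rel) := by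
  refine GradedAlgebra.ofAlgHom (grading R par rel)
    (RingQuot.liftAlgHom R ⟨splitFree R par rel, ?_⟩) ?_ ?_
  · intro x y h
    obtain ⟨a, hx, hy⟩ := hrel x y h
    rw [splitFree_mem R par rel hx, splitFree_mem R par rel hy]
    congr 2
    exact RingQuot.mkAlgHom_rel R h
  · apply RingQuot.ringQuot_ext'
    ext g
    simp [splitFree]
  · rintro a ⟨_, x, hx, rfl⟩
    have h := splitFree_mem R par rel hx
    rw [DirectSum.lof_eq_of] at h
    simpa using h

end

end SuperPresentation

/-! ### The root datum of `sl(V)` and the Drinfeld super Yangian -/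

namespace SuperYangian

open SuperPresentation

section RootDatum

variable {N : ℕ} (p : Fin (N + 1) → ZMod 2)

/-- The form on `P = ⨁ ℤ ε_k` with `(ε_k, ε_l) = δ_{kl} (-1)^{p k}`, where `p k` is the parity
of the `k`-th basis vector of `V`. -/
def form (u v : Fin (N + 1) → ℤ) : ℤ := ∑ k, sgn (p k) * (u k * v k)

/-- The simple root `α_i = ε_i - ε_{i+1}`. -/
def simpleRoot (i : Fin N) : Fin (N + 1) → ℤ :=
  Pi.single i.castSucc 1 - Pi.single i.succ 1

/-- The Cartan matrix `c_{ij} = (α_i, α_j)`. -/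
def cartan (i j : Fin N) : ℤ := form p (simpleRoot i) (simpleRoot j)

/-- The parity `|α_i|`, the sum of the parities of the `i`-th and `(i+1)`-st basis vectors. -/
def rootParity (i : Fin N) : ZMod 2 := p i.castSucc + p i.succ

/-- Neighbouring vertices of the Dynkin diagram: `j = i ± 1`. -/
def Neighbour (i j : Fin N) : Prop := (i : ℕ) + 1 = j ∨ (j : ℕ) + 1 = i

end RootDatum

/-- Generators `h_{i,r}` and `x^±_{i,r}` with `i ∈ I = Fin N` and level `r ∈ L`.
The sign `±` is an element of `ℤˣ = {1, -1}`. -/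
inductive Gen (N : ℕ) (L : Type) : Type
  | h (i : Fin N) (r : L) : Gen N L
  | x (ε : ℤˣ) (i : Fin N) (r : L) : Gen N L

section

variable (𝕜 : Type*) [Field 𝕜] {N : ℕ} (p : Fin (N + 1) → ZMod 2)

/-- The parities `|h_{i,r}| = 0`, `|x^±_{i,r}| = |α_i|`. -/
def Gen.parity {L : Type} : Gen N L → ZMod 2
  | .h _ _ => 0
  | .x _ i _ => rootParity p i

/-- The scalar `ħ / 2` of `𝕜[[ħ]]`. -/
def halfHbar : PowerSeries 𝕜 := PowerSeries.C (1 / 2 : 𝕜) * PowerSeries.X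

/-- Homogeneous elements of the free `𝕜[[ħ]]`-superalgebra on the generators of levels `L`. -/
abbrev Elt (L : Type) : Type _ := Homog (PowerSeries 𝕜) (Gen.parity (L := L) p)

/-- A generator as a homogeneous element of the free superalgebra. -/
def gen {L : Type} (g : Gen N L) : Elt 𝕜 p L :=
  ⟨g.parity p, FreeAlgebra.ι _ g, ι_mem_freeGrading _ _ g⟩

/-- `h_{i,r}` in the free superalgebra. -/
abbrev fh {L : Type} (i : Fin N) (r : L) : Elt 𝕜 p L := gen 𝕜 p (.h i r)

/-- `x^±_{i,r}` in the free superalgebra. -/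
abbrev fx {L : Type} (ε : ℤˣ) (i : Fin N) (r : L) : Elt 𝕜 p L := gen 𝕜 p (.x ε i r)

/-- The defining relations of the Drinfeld super Yangian. -/
inductive YangianRel : FreeAlgebra (PowerSeries 𝕜) (Gen N ℕ) →
    FreeAlgebra (PowerSeries 𝕜) (Gen N ℕ) → Prop
  | hh (i j : Fin N) (r s : ℕ) :
      YangianRel ((fh 𝕜 p i r).comm (fh 𝕜 p j s)).val 0
  | h0x (ε : ℤˣ) (i j : Fin N) (s : ℕ) :
      YangianRel ((fh 𝕜 p i 0).comm (fx 𝕜 p ε j s)).val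
        (((ε : ℤ) * cartan p i j) • (fx 𝕜 p ε j s).val)
  | xx_same (i : Fin N) (r s : ℕ) :
      YangianRel ((fx 𝕜 p 1 i r).comm (fx 𝕜 p (-1) i s)).val (fh 𝕜 p i (r + s)).val
  | xx_ne (i j : Fin N) (r s : ℕ) (hij : i ≠ j) :
      YangianRel ((fx 𝕜 p 1 i r).comm (fx 𝕜 p (-1) j s)).val 0
  | hx (ε : ℤˣ) (i j : Fin N) (r s : ℕ) (hij : ¬ (i = j ∧ rootParity p i = 1)) :
      YangianRel
        (((fh 𝕜 p i (r + 1)).comm (fx 𝕜 p ε j s)).val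
          - ((fh 𝕜 p i r).comm (fx 𝕜 p ε j (s + 1))).val)
        (((ε : ℤ) * cartan p i j) • halfHbar 𝕜 • ((fh 𝕜 p i r).anti (fx 𝕜 p ε j s)).val)
  | xx (ε : ℤˣ) (i j : Fin N) (r s : ℕ) (hij : ¬ (i = j ∧ rootParity p i = 1)) :
      YangianRel
        (((fx 𝕜 p ε i (r + 1)).comm (fx 𝕜 p ε j s)).val
          - ((fx 𝕜 p ε i r).comm (fx 𝕜 p ε j (s + 1))).val)
        (((ε : ℤ) * cartan p i j) • halfHbar 𝕜 • ((fx 𝕜 p ε i r).anti (fx 𝕜 p ε j s)).val)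
  | hx_odd (ε : ℤˣ) (i : Fin N) (r s : ℕ) (hi : rootParity p i = 1) :
      YangianRel ((fh 𝕜 p i r).comm (fx 𝕜 p ε i s)).val 0
  | xx_zero (ε : ℤˣ) (i j : Fin N) (r s : ℕ) (hij : cartan p i j = 0) :
      YangianRel ((fx 𝕜 p ε i r).comm (fx 𝕜 p ε j s)).val 0
  | cubic (ε : ℤˣ) (i j : Fin N) (r s t : ℕ) (hij : Neighbour i j)
      (hi : rootParity p i = 0) :
      YangianRel
        (((fx 𝕜 p ε i r).comm ((fx 𝕜 p ε i s).comm (fx 𝕜 p ε j t))).val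
          + ((fx 𝕜 p ε i s).comm ((fx 𝕜 p ε i r).comm (fx 𝕜 p ε j t))).val) 0
  | quartic (ε : ℤˣ) (i j k : Fin N) (r s : ℕ) (hij : (i : ℕ) + 1 = j)
      (hjk : (j : ℕ) + 1 = k) (hj : rootParity p j = 1) :
      YangianRel
        (((fx 𝕜 p ε i r).comm (fx 𝕜 p ε j 0)).comm
          ((fx 𝕜 p ε j 0).comm (fx 𝕜 p ε k s))).val 0

/-- The element `h_{i1} - (ħ/2) h_{i0}^2` of the free superalgebra, of parity `0`. -/
def hTilde (i : Fin N) : Elt 𝕜 p (Fin 2) where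
  deg := 0
  val := (fh 𝕜 p i (1 : Fin 2)).val - halfHbar 𝕜 • (fh 𝕜 p i (0 : Fin 2)).val ^ 2
  mem := by
    refine sub_mem (fh 𝕜 p i (1 : Fin 2)).mem (Submodule.smul_mem _ _ ?_)
    have h := SetLike.pow_mem_graded 2 (fh 𝕜 p i (0 : Fin 2)).mem
    simpa [gen, Gen.parity] using h

/-- The finite list of relations of the minimalistic presentation; the levels lie in
`Fin 2 = {0, 1}`. -/
inductive MinimalRel : FreeAlgebra (PowerSeries 𝕜) (Gen N (Fin 2)) →
    FreeAlgebra (PowerSeries 𝕜) (Gen N (Fin 2)) → Prop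
  | hh (i j : Fin N) (r s : Fin 2) :
      MinimalRel ((fh 𝕜 p i r).comm (fh 𝕜 p j s)).val 0
  | h0x (ε : ℤˣ) (i j : Fin N) (s : Fin 2) :
      MinimalRel ((fh 𝕜 p i (0 : Fin 2)).comm (fx 𝕜 p ε j s)).val
        (((ε : ℤ) * cartan p i j) • (fx 𝕜 p ε j s).val)
  | xx_same (i : Fin N) (r s t : Fin 2) (hrs : (r : ℕ) + s = t) :
      MinimalRel ((fx 𝕜 p 1 i r).comm (fx 𝕜 p (-1) i s)).val (fh 𝕜 p i t).val
  | xx_ne (i j : Fin N) (r s : Fin 2) (hrs : (r : ℕ) + s ≤ 1) (hij : i ≠ j) :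
      MinimalRel ((fx 𝕜 p 1 i r).comm (fx 𝕜 p (-1) j s)).val 0
  | hx (ε : ℤˣ) (i j : Fin N) (hij : ¬ (i = j ∧ rootParity p i = 1)) :
      MinimalRel ((hTilde 𝕜 p i).comm (fx 𝕜 p ε j (0 : Fin 2))).val
        (((ε : ℤ) * cartan p i j) • (fx 𝕜 p ε j (1 : Fin 2)).val)
  | xx (ε : ℤˣ) (i j : Fin N) (hij : ¬ (i = j ∧ rootParity p i = 1)) :
      MinimalRel
        (((fx 𝕜 p ε i (1 : Fin 2)).comm (fx 𝕜 p ε j (0 : Fin 2))).val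
          - ((fx 𝕜 p ε i (0 : Fin 2)).comm (fx 𝕜 p ε j (1 : Fin 2))).val)
        (((ε : ℤ) * cartan p i j) • halfHbar 𝕜 •
          ((fx 𝕜 p ε i (0 : Fin 2)).anti (fx 𝕜 p ε j (0 : Fin 2))).val)
  | hx_odd (ε : ℤˣ) (i : Fin N) (s : Fin 2) (hi : rootParity p i = 1) :
      MinimalRel ((fh 𝕜 p i (1 : Fin 2)).comm (fx 𝕜 p ε i s)).val 0
  | xx_zero (ε : ℤˣ) (i j : Fin N) (hij : cartan p i j = 0) :
      MinimalRel ((fx 𝕜 p ε i (0 : Fin 2)).comm (fx 𝕜 p ε j (0 : Fin 2))).val 0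
  | cubic (ε : ℤˣ) (i j : Fin N) (hij : Neighbour i j) (hi : rootParity p i = 0) :
      MinimalRel
        ((fx 𝕜 p ε i (0 : Fin 2)).comm
          ((fx 𝕜 p ε i (0 : Fin 2)).comm (fx 𝕜 p ε j (0 : Fin 2)))).val 0
  | quartic (ε : ℤˣ) (i j k : Fin N) (hij : (i : ℕ) + 1 = j) (hjk : (j : ℕ) + 1 = k)
      (hj : rootParity p j = 1) :
      MinimalRel
        (((fx 𝕜 p ε i (0 : Fin 2)).comm (fx 𝕜 p ε j (0 : Fin 2))).comm
          ((fx 𝕜 p ε j (0 : Fin 2)).comm (fx 𝕜 p ε k (0 : Fin 2)))).val 0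

/-- The Drinfeld super Yangian `Y_ħ(sl(V))` over `𝕜[[ħ]]`. -/
abbrev Yangian : Type _ := RingQuot (YangianRel 𝕜 p)

/-- The superalgebra of the minimalistic presentation. -/
abbrev MinimalYangian : Type _ := RingQuot (MinimalRel 𝕜 p)

/-- The `ℤ/2`-grading of the Drinfeld super Yangian. -/
abbrev Yangian.parityPart (a : ZMod 2) : Submodule (PowerSeries 𝕜) (Yangian 𝕜 p) :=
  grading (PowerSeries 𝕜) (Gen.parity p) (YangianRel 𝕜 p) a

/-- The `ℤ/2`-grading of the superalgebra of the minimalistic presentation. -/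
abbrev MinimalYangian.parityPart (a : ZMod 2) :
    Submodule (PowerSeries 𝕜) (MinimalYangian 𝕜 p) :=
  grading (PowerSeries 𝕜) (Gen.parity p) (MinimalRel 𝕜 p) a

lemma yangianRel_homogeneous (a b : FreeAlgebra (PowerSeries 𝕜) (Gen N ℕ))
    (h : YangianRel 𝕜 p a b) : ∃ d, a ∈ freeGrading (PowerSeries 𝕜) (Gen.parity p) d ∧
      b ∈ freeGrading (PowerSeries 𝕜) (Gen.parity p) d := by
  cases h with
  | hh => exact ⟨_, Homog.mem _, zero_mem _⟩
  | h0x ε i j s =>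
    refine ⟨_, Homog.mem _, zsmul_mem ?_ _⟩
    simpa [Homog.comm, gen, Gen.parity] using (fx 𝕜 p ε j s).mem
  | xx_same i r s =>
    refine ⟨_, Homog.mem _, ?_⟩
    simpa [Homog.comm, gen, Gen.parity, CharTwo.add_self_eq_zero] using (fh 𝕜 p i (r + s)).mem
  | xx_ne => exact ⟨_, Homog.mem _, zero_mem _⟩
  | hx ε i j r s =>
    exact ⟨_, sub_mem (Homog.mem _) ((fh 𝕜 p i r).comm (fx 𝕜 p ε j (s + 1))).mem,
      zsmul_mem (Submodule.smul_mem _ _ ((fh 𝕜 p i r).anti (fx 𝕜 p ε j s)).mem) _⟩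
  | xx ε i j r s =>
    exact ⟨_, sub_mem (Homog.mem _) ((fx 𝕜 p ε i r).comm (fx 𝕜 p ε j (s + 1))).mem,
      zsmul_mem (Submodule.smul_mem _ _ ((fx 𝕜 p ε i r).anti (fx 𝕜 p ε j s)).mem) _⟩
  | hx_odd => exact ⟨_, Homog.mem _, zero_mem _⟩
  | xx_zero => exact ⟨_, Homog.mem _, zero_mem _⟩
  | cubic ε i j r s t =>
    exact ⟨_, add_mem (Homog.mem _)
      ((fx 𝕜 p ε i s).comm ((fx 𝕜 p ε i r).comm (fx 𝕜 p ε j t))).mem, zero_mem _⟩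
  | quartic => exact ⟨_, Homog.mem _, zero_mem _⟩

lemma minimalRel_homogeneous (a b : FreeAlgebra (PowerSeries 𝕜) (Gen N (Fin 2)))
    (h : MinimalRel 𝕜 p a b) : ∃ d, a ∈ freeGrading (PowerSeries 𝕜) (Gen.parity p) d ∧
      b ∈ freeGrading (PowerSeries 𝕜) (Gen.parity p) d := by
  cases h with
  | hh => exact ⟨_, Homog.mem _, zero_mem _⟩
  | h0x ε i j s =>
    refine ⟨_, Homog.mem _, zsmul_mem ?_ _⟩
    simpa [Homog.comm, gen, Gen.parity] using (fx 𝕜 p ε j s).mem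
  | xx_same i r s t =>
    refine ⟨_, Homog.mem _, ?_⟩
    simpa [Homog.comm, gen, Gen.parity, CharTwo.add_self_eq_zero] using (fh 𝕜 p i t).mem
  | xx_ne => exact ⟨_, Homog.mem _, zero_mem _⟩
  | hx ε i j =>
    refine ⟨_, Homog.mem _, zsmul_mem ?_ _⟩
    simpa [Homog.comm, hTilde, gen, Gen.parity] using (fx 𝕜 p ε j (1 : Fin 2)).mem
  | xx ε i j =>
    exact ⟨_, sub_mem (Homog.mem _)
        ((fx 𝕜 p ε i (0 : Fin 2)).comm (fx 𝕜 p ε j (1 : Fin 2))).mem,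
      zsmul_mem (Submodule.smul_mem _ _
        ((fx 𝕜 p ε i (0 : Fin 2)).anti (fx 𝕜 p ε j (0 : Fin 2))).mem) _⟩
  | hx_odd => exact ⟨_, Homog.mem _, zero_mem _⟩
  | xx_zero => exact ⟨_, Homog.mem _, zero_mem _⟩
  | cubic => exact ⟨_, Homog.mem _, zero_mem _⟩
  | quartic => exact ⟨_, Homog.mem _, zero_mem _⟩

/-- The Drinfeld super Yangian is a superalgebra. -/
instance : GradedAlgebra (Yangian.parityPart 𝕜 p) :=
  gradedAlgebra _ _ _ (yangianRel_homogeneous 𝕜 p)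

/-- The minimalistic presentation defines a superalgebra. -/
instance : GradedAlgebra (MinimalYangian.parityPart 𝕜 p) :=
  gradedAlgebra _ _ _ (minimalRel_homogeneous 𝕜 p)

/-- The generator `h_{i,r}` of the Drinfeld super Yangian. -/
def Yangian.h (i : Fin N) (r : ℕ) : Yangian 𝕜 p :=
  RingQuot.mkAlgHom (PowerSeries 𝕜) (YangianRel 𝕜 p) (fh 𝕜 p i r).val

/-- The generator `x^±_{i,r}` of the Drinfeld super Yangian. -/
def Yangian.x (ε : ℤˣ) (i : Fin N) (r : ℕ) : Yangian 𝕜 p :=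
  RingQuot.mkAlgHom (PowerSeries 𝕜) (YangianRel 𝕜 p) (fx 𝕜 p ε i r).val

/-- The generator `h_{i,r}`, `r ∈ {0, 1}`, of the minimalistic presentation. -/
def MinimalYangian.h (i : Fin N) (r : Fin 2) : MinimalYangian 𝕜 p :=
  RingQuot.mkAlgHom (PowerSeries 𝕜) (MinimalRel 𝕜 p) (fh 𝕜 p i r).val

/-- The generator `x^±_{i,r}`, `r ∈ {0, 1}`, of the minimalistic presentation. -/
def MinimalYangian.x (ε : ℤˣ) (i : Fin N) (r : Fin 2) : MinimalYangian 𝕜 p :=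
  RingQuot.mkAlgHom (PowerSeries 𝕜) (MinimalRel 𝕜 p) (fx 𝕜 p ε i r).val

end

end SuperYangian

end

/-!
Put `T i = h i 1 - (ħ / 2) (h i 0)²`. The minimal relations say that bracketing with `T i` raises
the level of `x ε j 0` with coefficient `± cᵢⱼ`, and this forces the definition of all higher
`x ε j r`. Combinations of the `T i` with prescribed weights on two distinct vertices exist because
the root lattice separates vertices; the only obstruction occurs for `N = 3` and superdimension
zero. They move the two levels of a relation between distinct vertices independently, so such
relations propagate from level zero to all levels.

At a single vertex only the total level can be raised by one in this way. A neighbour `k` provides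
in addition a cubic correction of `3 h k 2`, which commutes with the Cartan part and raises levels
by two. The commutators of two Cartan currents along an antidiagonal form an arithmetic
progression, and comparing its two ends shows that it vanishes.
-/

namespace SuperYangian

open SuperPresentation

attribute [local instance] LieRing.ofAssociativeRing

section SymmetricFamily

variable {A : Type*} [AddCommGroup A] {Z : ℕ → ℕ → A}

lemma antidiagonal_eq_zero {n : ℕ} (h0 : Z 0 (n + 1) = 0)
    (h1 : ∀ r s, r + s = n → Z (r + 1) s + Z r (s + 1) = 0) (r s : ℕ) (hrs : r + s = n + 1) :
    Z r s = 0 := by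
  induction r generalizing s with
  | zero => rwa [← hrs, zero_add] at h0
  | succ r ih =>
    have h := h1 r s (by lia)
    rwa [ih (s + 1) (by lia), add_zero] at h

lemma symmetric_family_eq_zero [IsAddTorsionFree A] (hsymm : ∀ r s, Z r s = Z s r)
    (h0 : Z 0 0 = 0) (h1 : ∀ r s, Z r s = 0 → Z (r + 1) s + Z r (s + 1) = 0)
    (h2 : ∀ r s, Z r s = 0 → Z (r + 2) s + Z r (s + 2) = 0) (r s : ℕ) : Z r s = 0 := by
  induction hn : r + s using Nat.strong_induction_on generalizing r s with
  | _ n ih =>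
    have below : ∀ r s, r + s < n → Z r s = 0 := fun r s h => ih _ h r s rfl
    rcases n with _ | n
    · obtain ⟨rfl, rfl⟩ := Nat.add_eq_zero_iff.1 hn
      exact h0
    have alternate : ∀ r s, r + s = n → Z (r + 1) s + Z r (s + 1) = 0 := fun r s h =>
      h1 r s (below r s (by lia))
    refine antidiagonal_eq_zero (self_eq_neg.1 ?_) alternate r s hn
    rcases n with _ | n
    · rw [eq_neg_iff_add_eq_zero, ← alternate 0 0 rfl, hsymm 1 0]
    calc Z 0 (n + 2) = -Z 1 (n + 1) := eq_neg_of_add_eq_zero_right (alternate 0 (n + 1) (by lia))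
      _ = Z 2 n := (eq_neg_of_add_eq_zero_left (alternate 1 n (by lia))).symm
      _ = -Z 0 (n + 2) := eq_neg_of_add_eq_zero_left (h2 0 n (below 0 n (by lia)))

end SymmetricFamily

section TwistedCommutator

variable {R A : Type*} [CommRing R] [Ring A] [Algebra R A]

/-- The commutator twisted by an integer `s`. For homogeneous `a`, `b` the supercommutator is the
case `s = (-1)^{|a||b|}`, and the super anticommutator the case `s = -(-1)^{|a||b|}`. -/
def scomm (s : ℤ) (a b : A) : A := a * b - s • (b * a)

lemma scomm_one (a b : A) : scomm 1 a b = ⁅a, b⁆ := by rw [scomm, one_smul, Ring.lie_def]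

@[simp] lemma scomm_zero (s : ℤ) (a : A) : scomm s a 0 = 0 := by simp [scomm]

@[simp] lemma zero_scomm (s : ℤ) (a : A) : scomm s 0 a = 0 := by simp [scomm]

lemma scomm_smul (s : ℤ) (c : R) (a b : A) : scomm s a (c • b) = c • scomm s a b := by
  simp only [scomm, mul_smul_comm, smul_mul_assoc]; module

lemma smul_scomm (s : ℤ) (c : R) (a b : A) : scomm s (c • a) b = c • scomm s a b := by
  simp only [scomm, mul_smul_comm, smul_mul_assoc]; module

lemma lie_smul_algebra (c : R) (a b : A) : ⁅a, c • b⁆ = c • ⁅a, b⁆ := by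
  simpa only [scomm_one] using scomm_smul 1 c a b

lemma smul_algebra_lie (c : R) (a b : A) : ⁅c • a, b⁆ = c • ⁅a, b⁆ := by
  simpa only [scomm_one] using smul_scomm 1 c a b

lemma lie_scomm (H : A) (s : ℤ) (a b : A) :
    ⁅H, scomm s a b⁆ = scomm s ⁅H, a⁆ b + scomm s a ⁅H, b⁆ := by
  simp only [scomm, Ring.lie_def, mul_sub, sub_mul, mul_smul_comm, smul_mul_assoc, mul_assoc]
  module

lemma scomm_swap {s : ℤ} (hs : s = 1 ∨ s = -1) (a b : A) : scomm s a b = -s • scomm s b a := by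
  rcases hs with rfl | rfl <;> simp only [scomm] <;> module

/-- The defect of the quadratic relation
`[u_{r+1}, v_t] - [u_r, v_{t+1}] = κ {u_r, v_t}` between two currents. -/
def quadDefect (κ : R) (s : ℤ) (u v : ℕ → A) (r t : ℕ) : A :=
  scomm s (u (r + 1)) (v t) - scomm s (u r) (v (t + 1)) - κ • scomm (-s) (u r) (v t)

lemma quadDefect_congr {κ : R} {t : ℤ} {u u' v : ℕ → A} {r s : ℕ} (h : u r = u' r)
    (h' : u (r + 1) = u' (r + 1)) : quadDefect κ t u v r s = quadDefect κ t u' v r s := by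
  rw [quadDefect, h, h', quadDefect]

lemma quadDefect_scomm_const {s t : ℤ} (hs : s = 1 ∨ s = -1) {κ : R} {u v : ℕ → A} {y : A}
    {r n : ℕ} (huv : quadDefect κ s u v r n = 0) (h₀ : scomm s y (v n) = 0)
    (h₁ : scomm s y (v (n + 1)) = 0) : quadDefect κ 1 (fun r => scomm t (u r) y) v r n = 0 := by
  simp only [quadDefect, scomm] at huv h₀ h₁ ⊢
  rcases hs with rfl | rfl
  · linear_combination (norm := skip) huv * y - t • (y * huv) + u (r + 1) * h₀ - u r * h₁
      - t • (h₀ * u (r + 1)) + t • (h₁ * u r) - κ • (u r * h₀) - κ • t • (h₀ * u r)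
    simp only [mul_sub, sub_mul, mul_smul_comm, smul_mul_assoc, mul_assoc, smul_sub, zero_mul,
      mul_zero, smul_zero]
    module
  · linear_combination (norm := skip) -(huv * y) - t • (y * huv) + u (r + 1) * h₀ - u r * h₁
      + t • (h₀ * u (r + 1)) - t • (h₁ * u r) - κ • (u r * h₀) + κ • t • (h₀ * u r)
    simp only [mul_sub, sub_mul, mul_smul_comm, smul_mul_assoc, mul_assoc, smul_sub, zero_mul,
      mul_zero, smul_zero]
    module

lemma lie_scomm_of_quadDefect {η : R} {s : ℤ} {h x y : ℕ → A} {r a b : ℕ}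
    (x₁ : quadDefect η 1 h x (r + 1) a = 0) (x₀ : quadDefect η 1 h x r a = 0)
    (y₁ : quadDefect (-η) 1 h y (r + 1) b = 0) (y₀ : quadDefect (-η) 1 h y r b = 0) :
    ⁅h (r + 2), scomm s (x a) (y b)⁆ =
      ⁅h (r + 1), scomm s (x (a + 1)) (y b) + scomm s (x a) (y (b + 1))⁆ -
        ⁅h r, scomm s (x (a + 1)) (y (b + 1))⁆ + η ^ 2 • ⁅h r, scomm s (x a) (y b)⁆ +
        η • scomm (-1) (h r) (scomm s (x (a + 1)) (y b) - scomm s (x a) (y (b + 1))) := by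
  simp only [quadDefect, scomm, Ring.lie_def] at *
  linear_combination (norm := skip) x₁ * y b + x a * y₁ - x₀ * y (b + 1) - x (a + 1) * y₀
    + η • (x₀ * y b) + η • (x a * y₀) - s • (y b * x₁ + y₁ * x a - y (b + 1) * x₀ - y₀ * x (a + 1))
    + (s • η) • (y b * x₀ + y₀ * x a)
  simp only [mul_sub, sub_mul, mul_add, add_mul, mul_smul_comm, smul_mul_assoc, mul_assoc,
    zero_mul, mul_zero]
  module

lemma quadDefect_swap {η : R} {h x : ℕ → A} {y : A} {r s : ℕ} (hh : ∀ a, h a = ⁅x a, y⁆)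
    (hxx : quadDefect η 1 x x r s = 0) :
    quadDefect η 1 h x r s = -quadDefect η 1 h x s r := by
  simp only [hh, quadDefect, scomm, Ring.lie_def] at *
  linear_combination (norm := skip) hxx * y - y * hxx
  simp only [mul_sub, sub_mul, mul_smul_comm, smul_mul_assoc, mul_assoc, zero_mul, mul_zero]
  module

lemma lie_swap_of_anticomm {h x : ℕ → A} {y : A} {r s : ℕ} (hh : ∀ a, h a = scomm (-1) (x a) y)
    (hxx : scomm (-1) (x r) (x s) = 0) : ⁅h r, x s⁆ = -⁅h s, x r⁆ := by
  simp only [hh, scomm, Ring.lie_def] at *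
  linear_combination (norm := skip) y * hxx - hxx * y
  simp only [mul_sub, sub_mul, mul_smul_comm, smul_mul_assoc, mul_assoc, mul_zero, zero_mul]
  module

lemma quadDefect_cartan_zero {lam : R} {γ : ℤ} {h x : ℕ → A} (e : ∀ r, ⁅h 0, x r⁆ = γ • x r)
    (r : ℕ) : quadDefect (γ • lam) 1 h x 0 r = ⁅h 1 - lam • h 0 ^ 2, x r⁆ - γ • x (r + 1) := by
  have e₀ := e r
  have e₁ := e (r + 1)
  simp only [quadDefect, scomm, Ring.lie_def] at *
  linear_combination (norm := skip) lam • (h 0 * e₀ + e₀ * h 0) - e₁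
  simp only [pow_two, mul_sub, sub_mul, mul_smul_comm, smul_mul_assoc, mul_assoc]
  module

/-- The quadratic and cubic corrections turn `3 h₂` into a combination of level shifts, just as
`h₁ - λ h₀²` is a pure level shift. -/
lemma lie_cubic_correction {lam : R} {γ : ℤ} {h x : ℕ → A} {r : ℕ}
    (e : ∀ r, ⁅h 0, x r⁆ = γ • x r) (a₀ : ∀ r, quadDefect (γ • lam) 1 h x 0 r = 0)
    (a₁ : quadDefect (γ • lam) 1 h x 1 r = 0) :
    ⁅(3 : ℤ) • h 2 - ((3 : ℤ) • lam) • scomm (-1) (h 0) (h 1) + ((4 : ℤ) • lam ^ 2) • h 0 ^ 3,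
      x r⁆ = (3 * γ) • x (r + 2) + (γ ^ 3 • lam ^ 2) • x r := by
  have e₀ := e r
  have e₁ := e (r + 1)
  have e₂ := e (r + 2)
  have a₀₀ := a₀ r
  have a₀₁ := a₀ (r + 1)
  simp only [quadDefect, scomm, Ring.lie_def] at *
  linear_combination (norm := skip) (3 : ℤ) • a₁ + (3 : ℤ) • (a₀₁ + e₂)
    - ((3 : ℤ) • lam) • (h 0 * (a₀₀ + e₁) + (a₀₀ + e₁) * h 0)
    - ((3 : ℤ) • lam) • (h 1 * e₀ + e₀ * h 1)
    + ((4 : ℤ) • lam ^ 2) • (h 0 * h 0 * e₀ + h 0 * e₀ * h 0 + e₀ * (h 0 * h 0))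
    + (γ • lam ^ 2) • (h 0 * e₀ - e₀ * h 0 + γ • e₀)
  simp only [pow_succ, pow_zero, one_mul, mul_sub, sub_mul, mul_add, add_mul, mul_smul_comm,
    smul_mul_assoc, mul_assoc, zero_mul, mul_zero]
  module

section Shift

/-- `ad H` raises the level of the family `u` by `m`, up to the factor `a` and a multiple of the
identity. -/
def ActsAsShift (H : A) (m : ℕ) (a : ℤ) (b : R) (u : ℕ → A) : Prop :=
  ∀ r, ⁅H, u r⁆ = a • u (r + m) + b • u r

/-- `ad H` acts on the doubly indexed family `P` as `a` times the shift by `m` of the first level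
plus `a'` times that of the second, up to a multiple of the identity. -/
def ActsAsShift₂ (H : A) (m : ℕ) (a a' : ℤ) (b : R) (P : ℕ → ℕ → A) : Prop :=
  ∀ r t, ⁅H, P r t⁆ = a • P (r + m) t + a' • P r (t + m) + b • P r t

variable {H : A} {m : ℕ} {a a' : ℤ} {b b' : R} {u v : ℕ → A} {P : ℕ → ℕ → A}

lemma actsAsShift_one (h : ∀ r, ⁅H, u r⁆ = a • u (r + 1)) : ActsAsShift H 1 a (0 : R) u :=
  fun r => by rw [h, zero_smul, add_zero]

lemma actsAsShift_of_lie_eq_zero (h : ∀ r, ⁅H, u r⁆ = 0) : ActsAsShift H m 0 (0 : R) u :=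
  fun r => by rw [h, zero_smul, zero_smul, add_zero]

lemma ActsAsShift.scomm (hu : ActsAsShift H m a b u) (hv : ActsAsShift H m a' b' v) (s : ℤ) :
    ActsAsShift₂ H m a a' (b + b') fun r t => scomm s (u r) (v t) := fun r t => by
  simp only [lie_scomm, hu r, hv t]
  simp only [SuperYangian.scomm, mul_add, add_mul, mul_smul_comm, smul_mul_assoc]
  module

lemma ActsAsShift.quadDefect (hu : ActsAsShift H m a b u) (hv : ActsAsShift H m a' b' v) (κ : R)
    (s : ℤ) : ActsAsShift₂ H m a a' (b + b') (quadDefect κ s u v) := fun r t => by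
  have h : ∀ s r t, _ := fun s => hu.scomm hv s
  simp only [SuperYangian.quadDefect, lie_sub, lie_smul_algebra, h, add_right_comm _ 1 m]
  module

lemma ActsAsShift₂.add_apply_eq_zero [IsAddTorsionFree A]
    (h : ActsAsShift₂ H m a a b P) (ha : a ≠ 0) {r t : ℕ} (hP : P r t = 0) :
    P (r + m) t + P r (t + m) = 0 := by
  have e := h r t
  rwa [hP, lie_zero, smul_zero, add_zero, ← smul_add, eq_comm, smul_eq_zero_iff_right ha] at e

lemma ActsAsShift.eq_zero [IsAddTorsionFree A] (h : ActsAsShift H 1 a b u) (ha : a ≠ 0)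
    (h0 : u 0 = 0) (r : ℕ) : u r = 0 := by
  induction r with
  | zero => exact h0
  | succ r ih =>
    have e := h r
    rwa [ih, lie_zero, smul_zero, add_zero, eq_comm, smul_eq_zero_iff_right ha] at e

lemma ActsAsShift₂.fst (h : ActsAsShift₂ H m a 0 b P) (t : ℕ) :
    ActsAsShift H m a b fun r => P r t := fun r => by
  rw [h, zero_smul, add_zero]

lemma ActsAsShift₂.snd (h : ActsAsShift₂ H m 0 a b P) (r : ℕ) : ActsAsShift H m a b (P r) :=
  fun t => by rw [h, zero_smul, zero_add]

lemma ActsAsShift₂.eq_zero_of_isolating [IsAddTorsionFree A] {H' : A}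
    (h : ActsAsShift₂ H 1 a 0 b P) (h' : ActsAsShift₂ H' 1 0 a' b' P) (ha : a ≠ 0) (ha' : a' ≠ 0)
    (h0 : P 0 0 = 0) (r t : ℕ) : P r t = 0 :=
  (h'.snd r).eq_zero ha' ((h.fst 0).eq_zero ha h0 r) t

/-- The symmetrized triple commutator of the cubic relations. -/
def serre (u v : ℕ → A) (r s t : ℕ) : A := ⁅u r, ⁅u s, v t⁆⁆ + ⁅u s, ⁅u r, v t⁆⁆

lemma lie_serre (hu : ActsAsShift H m a b u) (hv : ActsAsShift H m a' b' v) (r s t : ℕ) :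
    ⁅H, serre u v r s t⁆ = a • (serre u v (r + m) s t + serre u v r (s + m) t) +
      a' • serre u v r s (t + m) + (b + b + b') • serre u v r s t := by
  have key : ∀ r s, ⁅H, ⁅u r, ⁅u s, v t⁆⁆⁆ = a • (⁅u (r + m), ⁅u s, v t⁆⁆ +
      ⁅u r, ⁅u (s + m), v t⁆⁆) + a' • ⁅u r, ⁅u s, v (t + m)⁆⁆ +
        (b + b + b') • ⁅u r, ⁅u s, v t⁆⁆ := fun r s => by
    simp only [leibniz_lie H, hu r, hu s, hv t, lie_add, add_lie, smul_lie, lie_smul,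
      lie_smul_algebra]
    module
  simp only [serre, lie_add, key]
  module

/-- The isolating operators `H`, `H'` carry the vanishing of the Serre element from
`(r, s, 0)` to `(r, s, t)`; this absorbs the shift of `v` by which `U` differs from an operator
acting on `u` only. -/
lemma serre_eq_zero [IsAddTorsionFree A] {H' U : A} {d d' : ℤ}
    (hu : ActsAsShift H 1 d (0 : R) u) (hv : ActsAsShift H 1 0 (0 : R) v)
    (hu' : ActsAsShift H' 1 0 (0 : R) u) (hv' : ActsAsShift H' 1 d' (0 : R) v)
    (hUu : ActsAsShift U 2 a b u) (hUv : ActsAsShift U 2 a' b' v)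
    (hd : d ≠ 0) (hd' : d' ≠ 0) (ha : a ≠ 0) (h0 : ⁅u 0, ⁅u 0, v 0⁆⁆ = 0) (r s t : ℕ) :
    serre u v r s t = 0 := by
  have raise : ∀ r s, serre u v r s 0 = 0 → ∀ t, serre u v r s t = 0 := fun r s =>
    ActsAsShift.eq_zero (H := H') (b := (0 : R) + 0 + 0) (fun t => by
      rw [lie_serre hu' hv', zero_smul, zero_add]) hd'
  refine raise r s (symmetric_family_eq_zero (Z := fun r s => serre u v r s 0)
    (fun r s => add_comm _ _) ?_ (fun r s h => ?_) (fun r s h => ?_) r s) t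
  · rw [serre, h0, add_zero]
  · have e := lie_serre hu hv r s 0
    rwa [h, lie_zero, zero_smul, add_zero, smul_zero, add_zero, eq_comm,
      smul_eq_zero_iff_right hd] at e
  · have e := lie_serre hUu hUv r s 0
    rwa [h, raise r s h, lie_zero, smul_zero, add_zero, smul_zero, add_zero, eq_comm,
      smul_eq_zero_iff_right ha] at e

end Shift

end TwistedCommutator

section RootDatum

lemma units_mul_ne_zero (ε : ℤˣ) {d : ℤ} (hd : d ≠ 0) : (ε : ℤ) * d ≠ 0 :=
  mul_ne_zero ε.ne_zero hd

lemma sgn_eq_one_or (a : ZMod 2) : sgn a = 1 ∨ sgn a = -1 := by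
  unfold sgn; split_ifs <;> simp

lemma sgn_mul_self (a : ZMod 2) : sgn a * sgn a = 1 := by
  rcases sgn_eq_one_or a with h | h <;> simp [h]

lemma cast_sgn (a : ZMod 2) : (sgn a : ZMod 2) = 1 := by
  rcases sgn_eq_one_or a with h | h <;> rw [h] <;> rfl

variable {N : ℕ} (p : Fin (N + 1) → ZMod 2)

/-- The sign `(-1)^{|α_i| |α_j|}`. -/
def rootSign (i j : Fin N) : ℤ := sgn (rootParity p i * rootParity p j)

/-- The superdimension of `V`. -/
def superdim : ℤ := ∑ k, sgn (p k)

/-- The superdimension of the span of `v_1, …, v_m`, where the basis vector `v_m` is indexed by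
`m.castSucc`. -/
def partialSuperdim (m : Fin N) : ℤ := ∑ k ∈ Finset.Iic m.castSucc, sgn (p k)

/-- The functionals on the simple roots that pairing with an element of the root lattice induces:
these are the integral combinations of the rows of the Cartan matrix. -/
def weightLattice : Submodule ℤ (Fin N → ℤ) := Submodule.span ℤ (Set.range (cartan p))

/-- Some element of the root lattice is orthogonal to `α_j` for all `j ∈ J`, but not to `α_i`. -/
def Isolated (i : Fin N) (J : Set (Fin N)) : Prop :=
  ∃ w ∈ weightLattice p, w i ≠ 0 ∧ ∀ j ∈ J, w j = 0

/-- The root lattice isolates each vertex from any other one, and each end of a chain of three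
vertices with odd middle from the rest of the chain; moreover no vertex is disconnected from all
others. These are the conditions under which the relations of low level generate those of all
levels. -/
structure IsSeparated : Prop where
  isolated_pair : ∀ i j, i ≠ j → Isolated p i {j}
  isolated_left : ∀ i j k : Fin N, (i : ℕ) + 1 = j → (j : ℕ) + 1 = k → Isolated p i {j, k}
  isolated_right : ∀ i j k : Fin N, (i : ℕ) + 1 = j → (j : ℕ) + 1 = k → Isolated p k {i, j}
  exists_joined : ∀ i, ∃ k, k ≠ i ∧ cartan p k i ≠ 0

variable {p} {i j k m : Fin N}

lemma rootSign_eq_one_or (i j : Fin N) : rootSign p i j = 1 ∨ rootSign p i j = -1 :=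
  sgn_eq_one_or _

lemma rootSign_comm (i j : Fin N) : rootSign p i j = rootSign p j i := by
  rw [rootSign, mul_comm, rootSign]

lemma rootSign_self_of_even (hi : rootParity p i = 0) : rootSign p i i = 1 := by
  simp [rootSign, hi, sgn]

lemma rootParity_eq_zero_of_ne_one (hi : rootParity p i ≠ 1) : rootParity p i = 0 := by
  have h : ∀ a : ZMod 2, a ≠ 1 → a = 0 := by decide
  exact h _ hi

lemma rootSign_self_of_odd (hi : rootParity p i = 1) : rootSign p i i = -1 := by
  simp [rootSign, hi, sgn]

lemma form_simpleRoot (v : Fin (N + 1) → ℤ) (i : Fin N) :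
    form p v (simpleRoot i) = sgn (p i.castSucc) * v i.castSucc - sgn (p i.succ) * v i.succ := by
  simp [form, simpleRoot, mul_sub, Pi.single_apply]

lemma cartan_comm (i j : Fin N) : cartan p i j = cartan p j i := by
  simp only [cartan, form, mul_comm (simpleRoot i _)]

lemma cartan_self (i : Fin N) : cartan p i i = sgn (p i.castSucc) + sgn (p i.succ) := by
  rw [cartan, form_simpleRoot]
  simp [simpleRoot, Fin.castSucc_lt_succ.ne, Fin.castSucc_lt_succ.ne']

lemma cartan_self_of_odd (hi : rootParity p i = 1) : cartan p i i = 0 := by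
  have h : ∀ a b : ZMod 2, a + b = 1 → sgn a + sgn b = 0 := by decide
  rw [cartan_self, h _ _ hi]

lemma cartan_self_of_even (hi : rootParity p i = 0) : cartan p i i ≠ 0 := by
  have h : ∀ a b : ZMod 2, a + b = 0 → sgn a + sgn b ≠ 0 := by decide
  rw [cartan_self]
  exact h _ _ hi

lemma Neighbour.symm (h : Neighbour i j) : Neighbour j i := Or.symm h

lemma Neighbour.ne (h : Neighbour i j) : i ≠ j := by
  rintro rfl
  rcases h with h | h <;> lia

lemma Neighbour.cartan_mul_self (h : Neighbour i j) : cartan p i j * cartan p i j = 1 := by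
  wlog hij : (i : ℕ) + 1 = j generalizing i j
  · rw [cartan_comm]
    exact this h.symm (h.resolve_left hij)
  have hsucc : i.succ = j.castSucc := Fin.ext hij
  have hc : cartan p i j = -sgn (p j.castSucc) := by
    have h₁ : j.castSucc ≠ i.castSucc := by rw [← hsucc]; exact Fin.castSucc_lt_succ.ne'
    have h₂ : j.succ ≠ i.castSucc := by simp only [ne_eq, Fin.ext_iff]; simp; lia
    rw [cartan, form_simpleRoot]
    simp [simpleRoot, hsucc, h₁, h₂, Fin.castSucc_lt_succ.ne']
  rw [hc, neg_mul_neg, sgn_mul_self]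

lemma Neighbour.units_mul_cartan_mul_self (ε : ℤˣ) (h : Neighbour i j) :
    ((ε : ℤ) * cartan p i j) * ((ε : ℤ) * cartan p i j) = 1 := by
  rw [mul_mul_mul_comm, h.cartan_mul_self, ← Units.val_mul, Int.units_mul_self, Units.val_one,
    one_mul]

lemma Neighbour.cartan_ne_zero (h : Neighbour i j) : cartan p i j ≠ 0 :=
  left_ne_zero_of_mul_eq_one h.cartan_mul_self

lemma exists_neighbour (hN : N ≠ 1) (i : Fin N) : ∃ k, Neighbour k i := by
  by_cases hi : (i : ℕ) + 1 < N
  · exact ⟨⟨i + 1, hi⟩, .inr rfl⟩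
  · exact ⟨⟨i - 1, by lia⟩, .inl (by simp only; lia)⟩

lemma single_sub_single_last_mem_span (l : Fin (N + 1)) :
    (Pi.single l 1 - Pi.single (Fin.last N) 1 : Fin (N + 1) → ℤ) ∈
      Submodule.span ℤ (Set.range simpleRoot) := by
  induction l using Fin.reverseInduction with
  | last => simp
  | cast i ih =>
    rw [← sub_add_sub_cancel _ (Pi.single i.succ 1)]
    exact add_mem (Submodule.subset_span ⟨i, rfl⟩) ih

lemma mem_span_simpleRoot {v : Fin (N + 1) → ℤ} (hv : ∑ k, v k = 0) :
    v ∈ Submodule.span ℤ (Set.range simpleRoot) := by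
  have h : v = ∑ l, v l • (Pi.single l 1 - Pi.single (Fin.last N) 1 : Fin (N + 1) → ℤ) := by
    simp only [smul_sub, Finset.sum_sub_distrib, ← Finset.sum_smul, hv, zero_smul, sub_zero]
    exact pi_eq_sum_univ' v
  rw [h]
  exact sum_mem fun l _ => Submodule.smul_mem _ _ (single_sub_single_last_mem_span l)

lemma sub_mem_weightLattice {y : Fin (N + 1) → ℤ} (hy : ∑ k, sgn (p k) * y k = 0) :
    (fun i : Fin N => y i.castSucc - y i.succ) ∈ weightLattice p := by
  let pairing : (Fin (N + 1) → ℤ) →ₗ[ℤ] Fin N → ℤ :=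
    { toFun v i := form p v (simpleRoot i)
      map_add' u v := by ext i; simp only [form_simpleRoot, Pi.add_apply]; ring
      map_smul' c v := by ext i; simp [form_simpleRoot]; ring }
  have h := Submodule.mem_map_of_mem (f := pairing) (mem_span_simpleRoot hy)
  rw [Submodule.map_span, ← Set.range_comp] at h
  change _ ∈ weightLattice p at h
  suffices heq : (fun i : Fin N => y i.castSucc - y i.succ) = pairing fun k => sgn (p k) * y k from
    heq ▸ h
  ext i
  change _ = form p _ (simpleRoot i)
  simp only [form_simpleRoot, ← mul_assoc, sgn_mul_self, one_mul]

lemma sum_sgn_mul_step (m : Fin N) :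
    ∑ k, sgn (p k) * (if k ≤ m.castSucc then 1 else 0) = partialSuperdim p m := by
  simp only [mul_ite, mul_one, mul_zero, ← Finset.sum_filter, partialSuperdim]
  congr 1
  ext
  simp

lemma step_sub_step (m i : Fin N) : ((if i.castSucc ≤ m.castSucc then 1 else 0) -
    if i.succ ≤ m.castSucc then 1 else 0 : ℤ) = if i = m then 1 else 0 := by
  simp only [Fin.ext_iff, Fin.le_def, Fin.val_castSucc, Fin.val_succ]
  split_ifs <;> lia

lemma Isolated.mono {J J' : Set (Fin N)} (h : Isolated p i J') (hJ : J ⊆ J') : Isolated p i J := by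
  obtain ⟨w, hw, hi, hw'⟩ := h
  exact ⟨w, hw, hi, fun j hj => hw' j (hJ hj)⟩

lemma isolated_of_superdim_ne_zero (h : superdim p ≠ 0) (i : Fin N) : Isolated p i {i}ᶜ := by
  refine ⟨_, sub_mem_weightLattice (p := p) (y := fun k =>
    superdim p * (if k ≤ i.castSucc then 1 else 0) - partialSuperdim p i) ?_, ?_, ?_⟩
  · simp only [mul_sub, Finset.sum_sub_distrib, mul_left_comm _ (superdim p), ← Finset.mul_sum,
      ← Finset.sum_mul, sum_sgn_mul_step]
    exact sub_self _
  · rw [sub_sub_sub_cancel_right, ← mul_sub, step_sub_step]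
    simpa using h
  · intro j hj
    rw [sub_sub_sub_cancel_right, ← mul_sub, step_sub_step, if_neg (by simpa using hj), mul_zero]

lemma isolated_of_partialSuperdim_ne_zero (h : partialSuperdim p m ≠ 0) (hm : m ≠ i) :
    Isolated p i {i, m}ᶜ := by
  refine ⟨_, sub_mem_weightLattice (p := p) (y := fun k =>
    partialSuperdim p m * (if k ≤ i.castSucc then 1 else 0) -
      partialSuperdim p i * (if k ≤ m.castSucc then 1 else 0)) ?_, ?_, ?_⟩
  · simp only [mul_sub, Finset.sum_sub_distrib, mul_left_comm _ (partialSuperdim p _),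
      ← Finset.mul_sum, sum_sgn_mul_step]
    ring
  · rw [sub_sub_sub_comm, ← mul_sub, ← mul_sub, step_sub_step, step_sub_step]
    simpa [hm.symm] using h
  · intro j hj
    rw [sub_sub_sub_comm, ← mul_sub, ← mul_sub, step_sub_step, step_sub_step]
    simp only [Set.mem_compl_iff, Set.mem_insert_iff, Set.mem_singleton_iff, not_or] at hj
    simp [hj.1, hj.2]

lemma partialSuperdim_ne_zero (hm : Even (m : ℕ)) : partialSuperdim p m ≠ 0 := fun h => by
  have h2 : (partialSuperdim p m : ZMod 2) = m + 1 := by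
    simp [partialSuperdim, cast_sgn]
  rw [h, (ZMod.natCast_eq_zero_iff_even).2 hm] at h2
  simp at h2

lemma odd_of_superdim_eq_zero (h : superdim p = 0) : Odd N := by
  have h2 : (superdim p : ZMod 2) = (N + 1 : ℕ) := by
    simp [superdim, cast_sgn]
  rw [h, Int.cast_zero, eq_comm, ZMod.natCast_eq_zero_iff_even] at h2
  exact Nat.not_even_iff_odd.1 (Nat.even_add_one.1 h2)

lemma exists_even_ne_of_five_le (hN : 5 ≤ N) {a b c : ℕ} (h : Odd a ∨ Odd b ∨ Odd c) :
    ∃ m : Fin N, Even (m : ℕ) ∧ (m : ℕ) ≠ a ∧ (m : ℕ) ≠ b ∧ (m : ℕ) ≠ c := by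
  suffices hm : ∃ m < 5, Even m ∧ m ≠ a ∧ m ≠ b ∧ m ≠ c by
    obtain ⟨m, hm, hm'⟩ := hm
    exact ⟨⟨m, by lia⟩, hm'⟩
  by_contra! hm
  have h0 := hm 0 (by lia) (by decide)
  have h2 := hm 2 (by lia) (by decide)
  have h4 := hm 4 (by lia) (by decide)
  simp only [Nat.odd_iff] at h
  lia

/-- If `sdim V = 0` then `N` is odd, so `N ≥ 5`, and one of the vertices `0`, `2`, `4` is available
as the auxiliary vertex `m` of `isolated_of_partialSuperdim_ne_zero`. -/
lemma isolated_of_subset (hN : N ≠ 1) (hS : N = 3 → superdim p ≠ 0) {J : Set (Fin N)} (hi : i ∉ J)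
    {a b c : ℕ} (hodd : Odd a ∨ Odd b ∨ Odd c)
    (hJ : ∀ j, j = i ∨ j ∈ J → (j : ℕ) = a ∨ (j : ℕ) = b ∨ (j : ℕ) = c) : Isolated p i J := by
  by_cases h : superdim p = 0
  · have h5 : 5 ≤ N := by
      have := odd_of_superdim_eq_zero h
      grind
    obtain ⟨m, hm, hmJ⟩ := exists_even_ne_of_five_le h5 hodd
    refine (isolated_of_partialSuperdim_ne_zero (partialSuperdim_ne_zero hm) ?_).mono ?_
    · rintro rfl
      grind
    · rintro j hj (rfl | rfl)
      · exact hi hj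
      · grind
  · refine (isolated_of_superdim_ne_zero h i).mono fun j hj => ?_
    rintro rfl
    exact hi hj

lemma isSeparated (hN : N ≠ 1) (hS : N = 3 → superdim p ≠ 0) : IsSeparated p where
  isolated_pair i j hij :=
    isolated_of_subset hN hS (a := i) (b := j) (c := 1) (by simpa) (by simp) (by simp)
  isolated_left i j k hij hjk :=
    isolated_of_subset hN hS (a := i) (b := j) (c := k) (by grind) (by grind) (by grind)
  isolated_right i j k hij hjk :=
    isolated_of_subset hN hS (a := i) (b := j) (c := k) (by grind) (by grind) (by grind)
  exists_joined i :=
    have ⟨k, hk⟩ := exists_neighbour hN i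
    ⟨k, hk.ne, hk.cartan_ne_zero⟩

lemma superdim_ne_zero_of_rootParity_ne {p : Fin 4 → ZMod 2}
    (h : rootParity p 0 ≠ rootParity p 2) : superdim p ≠ 0 := by
  revert p
  unfold rootParity superdim
  decide

end RootDatum

section Currents

variable {R A : Type*} [CommRing R] [Ring A] [Algebra R A] {N : ℕ}

/-- The quartic supercommutator `[[a, b], [b, c]]` of elements `a`, `b`, `c` that have the parities
of the vertices `i`, `j`, `k`. -/
def quarticComm (p : Fin (N + 1) → ZMod 2) (i j k : Fin N) (a b c : A) : A :=
  scomm (sgn ((rootParity p i + rootParity p j) * (rootParity p j + rootParity p k)))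
    (scomm (rootSign p i j) a b) (scomm (rootSign p j k) b c)

/-- Elements `x^±_{i,r}` of all levels `r` together with `h_{i,0}` and `h_{i,1}`, such that
`h_{i,1} - λ h_{i,0}^2` raises the level and the relations of the minimalistic presentation hold.
The Drinfeld relations with parameter `λ = ħ/2` will be deduced from these. -/
structure CurrentSystem (lam : R) (p : Fin (N + 1) → ZMod 2) (h₀ h₁ : Fin N → A)
    (x : ℤˣ → Fin N → ℕ → A) : Prop where
  lie_h₁_h₁ : ∀ i j, ⁅h₁ i, h₁ j⁆ = 0
  lie_h₀ : ∀ (ε : ℤˣ) i j r, ⁅h₀ i, x ε j r⁆ = ((ε : ℤ) * cartan p i j) • x ε j r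
  lie_shift : ∀ (ε : ℤˣ) i j r,
    ⁅h₁ i - lam • h₀ i ^ 2, x ε j r⁆ = ((ε : ℤ) * cartan p i j) • x ε j (r + 1)
  scomm_zero_zero : ∀ i, scomm (rootSign p i i) (x 1 i 0) (x (-1) i 0) = h₀ i
  scomm_one_zero : ∀ i, scomm (rootSign p i i) (x 1 i 1) (x (-1) i 0) = h₁ i
  scomm_zero_one : ∀ i, scomm (rootSign p i i) (x 1 i 0) (x (-1) i 1) = h₁ i
  scomm_of_ne : ∀ i j, i ≠ j → scomm (rootSign p i j) (x 1 i 0) (x (-1) j 0) = 0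
  quadDefect_zero : ∀ (ε : ℤˣ) i j, ¬(i = j ∧ rootParity p i = 1) →
    quadDefect (((ε : ℤ) * cartan p i j) • lam) (rootSign p i j) (x ε i) (x ε j) 0 0 = 0
  scomm_of_cartan_eq_zero : ∀ (ε : ℤˣ) i j, cartan p i j = 0 →
    scomm (rootSign p i j) (x ε i 0) (x ε j 0) = 0
  cubic : ∀ (ε : ℤˣ) i j, Neighbour i j → rootParity p i = 0 → ⁅x ε i 0, ⁅x ε i 0, x ε j 0⁆⁆ = 0
  quartic : ∀ (ε : ℤˣ) (i j k : Fin N), (i : ℕ) + 1 = j → (j : ℕ) + 1 = k → rootParity p j = 1 →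
    quarticComm p i j k (x ε i 0) (x ε j 0) (x ε k 0) = 0

/-- The supercommutator `[x^+_{i,a}, x^-_{i,b}]`. -/
def crossComm (p : Fin (N + 1) → ZMod 2) (x : ℤˣ → Fin N → ℕ → A) (i : Fin N) (a b : ℕ) : A :=
  scomm (rootSign p i i) (x 1 i a) (x (-1) i b)

/-- The Cartan current `h_{i,r} = [x^+_{i,r}, x^-_{i,0}]`. -/
def current (p : Fin (N + 1) → ZMod 2) (x : ℤˣ → Fin N → ℕ → A) (i : Fin N) (r : ℕ) : A :=
  crossComm p x i r 0

/-- Up to total level `n`, the supercommutators `[x^+_{i,a}, x^-_{i,b}]` depend on `a + b` only,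
likewise for `j`, and the currents of `i` and `j` commute. -/
structure CollapsesUpTo (p : Fin (N + 1) → ZMod 2) (x : ℤˣ → Fin N → ℕ → A) (i j : Fin N)
    (n : ℕ) : Prop where
  left : ∀ a b, a + b ≤ n → crossComm p x i a b = current p x i (a + b)
  right : ∀ a b, a + b ≤ n → crossComm p x j a b = current p x j (a + b)
  comm : ∀ r s, r + s ≤ n → ⁅current p x i r, current p x j s⁆ = 0

lemma CollapsesUpTo.symm {p : Fin (N + 1) → ZMod 2} {x : ℤˣ → Fin N → ℕ → A} {i j : Fin N} {n : ℕ}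
    (h : CollapsesUpTo p x i j n) : CollapsesUpTo p x j i n where
  left := h.right
  right := h.left
  comm r s hrs := by rw [← lie_skew, h.comm s r (by lia), neg_zero]

namespace CurrentSystem

variable {lam : R} {p : Fin (N + 1) → ZMod 2} {h₀ h₁ : Fin N → A} {x : ℤˣ → Fin N → ℕ → A}
  {i j k : Fin N}

lemma actsAsShift (S : CurrentSystem lam p h₀ h₁ x) (ε : ℤˣ) (k i : Fin N) :
    ActsAsShift (h₁ k - lam • h₀ k ^ 2) 1 (ε * cartan p k i) (0 : R) (x ε i) :=
  actsAsShift_one (S.lie_shift ε k i)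

lemma exists_lie_eq_smul_succ (S : CurrentSystem lam p h₀ h₁ x) {w : Fin N → ℤ}
    (hw : w ∈ weightLattice p) :
    ∃ H : A, ∀ ε j r, ⁅H, x ε j r⁆ = ((ε : ℤ) * w j) • x ε j (r + 1) := by
  induction hw using Submodule.span_induction with
  | mem w hw =>
    obtain ⟨k, rfl⟩ := hw
    exact ⟨_, fun ε j r => S.lie_shift ε k j r⟩
  | zero => exact ⟨0, fun ε j r => by simp⟩
  | add v w _ _ hv hw =>
    obtain ⟨⟨H, hH⟩, ⟨H', hH'⟩⟩ := hv, hw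
    refine ⟨H + H', fun ε j r => ?_⟩
    rw [add_lie, hH, hH', ← add_smul, ← mul_add, Pi.add_apply]
  | smul c w _ hw =>
    obtain ⟨H, hH⟩ := hw
    refine ⟨c • H, fun ε j r => ?_⟩
    rw [smul_lie, hH, smul_smul, mul_left_comm, Pi.smul_apply, smul_eq_mul]

lemma exists_isolating (S : CurrentSystem lam p h₀ h₁ x) {J : Set (Fin N)} (h : Isolated p i J) :
    ∃ H : A, ∃ d : ℤ, d ≠ 0 ∧ (∀ ε : ℤˣ, ActsAsShift H 1 (ε * d) (0 : R) (x ε i)) ∧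
      ∀ ε, ∀ j ∈ J, ActsAsShift H 1 0 (0 : R) (x ε j) := by
  obtain ⟨w, hw, hi, hJ⟩ := h
  obtain ⟨H, hH⟩ := S.exists_lie_eq_smul_succ hw
  exact ⟨H, w i, hi, fun ε => actsAsShift_one (hH ε i), fun ε j hj =>
    actsAsShift_of_lie_eq_zero fun r => by rw [hH, hJ j hj, mul_zero, zero_smul]⟩

lemma lie_h₀_crossComm (S : CurrentSystem lam p h₀ h₁ x) (k i : Fin N) (a b : ℕ) :
    ⁅h₀ k, crossComm p x i a b⁆ = 0 := by
  rw [crossComm, lie_scomm, S.lie_h₀, S.lie_h₀, smul_scomm, scomm_smul, ← add_smul]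
  simp

lemma lie_shift_crossComm (S : CurrentSystem lam p h₀ h₁ x) (k i : Fin N) (a b : ℕ) :
    ⁅h₁ k - lam • h₀ k ^ 2, crossComm p x i a b⁆ =
      cartan p k i • (crossComm p x i (a + 1) b - crossComm p x i a (b + 1)) := by
  rw [crossComm, lie_scomm, S.lie_shift, S.lie_shift, smul_scomm, scomm_smul, crossComm, crossComm]
  simp only [Units.val_one, Units.val_neg]
  module

lemma lie_h₁_crossComm (S : CurrentSystem lam p h₀ h₁ x) (k i : Fin N) (a b : ℕ) :
    ⁅h₁ k, crossComm p x i a b⁆ =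
      cartan p k i • (crossComm p x i (a + 1) b - crossComm p x i a (b + 1)) := by
  have hcomm : Commute (h₀ k) (crossComm p x i a b) := sub_eq_zero.1 (S.lie_h₀_crossComm k i a b)
  rw [← S.lie_shift_crossComm, sub_lie, smul_algebra_lie, (hcomm.pow_left 2).lie_eq, smul_zero,
    sub_zero]

lemma current_zero (S : CurrentSystem lam p h₀ h₁ x) (i : Fin N) : current p x i 0 = h₀ i :=
  S.scomm_zero_zero i

lemma current_one (S : CurrentSystem lam p h₀ h₁ x) (i : Fin N) : current p x i 1 = h₁ i :=
  S.scomm_one_zero i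

lemma lie_h₀_current (S : CurrentSystem lam p h₀ h₁ x) (k i : Fin N) (r : ℕ) :
    ⁅h₀ k, current p x i r⁆ = 0 :=
  S.lie_h₀_crossComm k i r 0

lemma quadDefect_current_zero (S : CurrentSystem lam p h₀ h₁ x) (ε : ℤˣ) (i j : Fin N) (s : ℕ) :
    quadDefect (((ε : ℤ) * cartan p i j) • lam) 1 (current p x i) (x ε j) 0 s = 0 := by
  have e := quadDefect_cartan_zero (lam := lam) (h := current p x i) (x := x ε j)
    (γ := ε * cartan p i j) (by simpa only [S.current_zero] using S.lie_h₀ ε i j) s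
  rw [e, S.current_zero, S.current_one, S.lie_shift, sub_self]

lemma exists_double_shift (S : CurrentSystem lam p h₀ h₁ x) (k : Fin N) : ∃ U : A, ∀ j,
    (∀ (ε : ℤˣ) r,
      quadDefect (((ε : ℤ) * cartan p k j) • lam) 1 (current p x k) (x ε j) 1 r = 0) →
    ∀ ε : ℤˣ, ActsAsShift U 2 (3 * (ε * cartan p k j)) (((ε : ℤ) * cartan p k j) ^ 3 • lam ^ 2)
      (x ε j) :=
  ⟨_, fun j h ε r => lie_cubic_correction (by simpa only [S.current_zero] using S.lie_h₀ ε k j)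
    (S.quadDefect_current_zero ε k j) (h ε r)⟩

variable [IsAddTorsionFree A]

/-- A relation between two distinct vertices propagates from level zero to all levels. -/
lemma eq_zero_of_ne (S : CurrentSystem lam p h₀ h₁ x) (hp : IsSeparated p) (hij : i ≠ j)
    {ε ε' : ℤˣ} {P : ℕ → ℕ → A}
    (hP : ∀ H a a', ActsAsShift H 1 a (0 : R) (x ε i) → ActsAsShift H 1 a' (0 : R) (x ε' j) →
      ActsAsShift₂ H 1 a a' (0 + 0 : R) P) (h0 : P 0 0 = 0) (r s : ℕ) : P r s = 0 := by
  obtain ⟨H, d, hd, hi, hj⟩ := S.exists_isolating (hp.isolated_pair i j hij)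
  obtain ⟨H', d', hd', hj', hi'⟩ := S.exists_isolating (hp.isolated_pair j i hij.symm)
  exact (hP H _ _ (hi ε) (hj ε' j rfl)).eq_zero_of_isolating (hP H' _ _ (hi' ε i rfl) (hj' ε'))
    (units_mul_ne_zero ε hd) (units_mul_ne_zero ε' hd') h0 r s

lemma scomm_pos_neg_eq_zero (S : CurrentSystem lam p h₀ h₁ x) (hp : IsSeparated p) (hij : i ≠ j)
    (r s : ℕ) : scomm (rootSign p i j) (x 1 i r) (x (-1) j s) = 0 :=
  S.eq_zero_of_ne hp hij (P := fun r s => scomm (rootSign p i j) (x 1 i r) (x (-1) j s))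
    (fun _ _ _ hi hj => hi.scomm hj _) (S.scomm_of_ne i j hij) r s

lemma scomm_neg_pos_eq_zero (S : CurrentSystem lam p h₀ h₁ x) (hp : IsSeparated p) (hij : i ≠ j)
    (r s : ℕ) : scomm (rootSign p i j) (x (-1) i r) (x 1 j s) = 0 := by
  rw [scomm_swap (rootSign_eq_one_or i j), rootSign_comm, S.scomm_pos_neg_eq_zero hp hij.symm,
    smul_zero]

lemma scomm_eq_zero_of_ne (S : CurrentSystem lam p h₀ h₁ x) (hp : IsSeparated p) (hij : i ≠ j)
    (hc : cartan p i j = 0) (ε : ℤˣ) (r s : ℕ) :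
    scomm (rootSign p i j) (x ε i r) (x ε j s) = 0 :=
  S.eq_zero_of_ne hp hij (P := fun r s => scomm (rootSign p i j) (x ε i r) (x ε j s))
    (fun _ _ _ hi hj => hi.scomm hj _) (S.scomm_of_cartan_eq_zero ε i j hc) r s

lemma quadDefect_eq_zero_of_ne (S : CurrentSystem lam p h₀ h₁ x) (hp : IsSeparated p) (hij : i ≠ j)
    (ε : ℤˣ) (r s : ℕ) :
    quadDefect (((ε : ℤ) * cartan p i j) • lam) (rootSign p i j) (x ε i) (x ε j) r s = 0 :=
  S.eq_zero_of_ne hp hij (fun _ _ _ hi hj => hi.quadDefect hj _ _)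
    (S.quadDefect_zero ε i j fun h => hij h.1) r s

lemma quadDefect_current_pos_of_ne (S : CurrentSystem lam p h₀ h₁ x) (hp : IsSeparated p)
    (hij : i ≠ j) (r s : ℕ) :
    quadDefect (cartan p i j • lam) 1 (current p x i) (x 1 j) r s = 0 := by
  have h := S.quadDefect_eq_zero_of_ne hp hij 1 r s
  rw [Units.val_one, one_mul] at h
  exact quadDefect_scomm_const (rootSign_eq_one_or i j) h (S.scomm_neg_pos_eq_zero hp hij 0 s)
    (S.scomm_neg_pos_eq_zero hp hij 0 (s + 1))

lemma quadDefect_crossComm_neg_of_ne (S : CurrentSystem lam p h₀ h₁ x) (hp : IsSeparated p)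
    (hij : i ≠ j) (r s : ℕ) :
    quadDefect (-(cartan p i j • lam)) 1 (crossComm p x i 0) (x (-1) j) r s = 0 := by
  have h := S.quadDefect_eq_zero_of_ne hp hij (-1) r s
  rw [Units.val_neg, Units.val_one, neg_one_mul, neg_smul] at h
  have hy : ∀ s, scomm (rootSign p i j) (-rootSign p i i • x 1 i 0) (x (-1) j s) = 0 := fun s => by
    rw [smul_scomm, S.scomm_pos_neg_eq_zero hp hij, smul_zero]
  have e : crossComm p x i 0 =
      fun r => scomm (rootSign p i i) (x (-1) i r) (-rootSign p i i • x 1 i 0) := funext fun r => by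
    rw [crossComm, scomm_swap (rootSign_eq_one_or i i), scomm_smul]
  rw [e]
  exact quadDefect_scomm_const (rootSign_eq_one_or i j) h (hy s) (hy (s + 1))

/-- Along an antidiagonal the commutators of the currents of `i` and `j` have vanishing second
differences. -/
lemma lie_current_recursion (S : CurrentSystem lam p h₀ h₁ x) (hp : IsSeparated p)
    (hij : i ≠ j) {n : ℕ} (hn : CollapsesUpTo p x i j n) {r m : ℕ} (hrm : r + m + 2 = n) :
    ⁅current p x i (r + 2), current p x j (m + 1)⁆ =
      (2 : ℤ) • ⁅current p x i (r + 1), current p x j (m + 2)⁆ -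
        ⁅current p x i r, current p x j (m + 3)⁆ := by
  have neg : ∀ r, r + 1 ≤ n →
      quadDefect (-(cartan p i j • lam)) 1 (current p x i) (x (-1) j) r 0 = 0 := fun r hr => by
    rw [← S.quadDefect_crossComm_neg_of_ne hp hij r 0]
    refine quadDefect_congr ?_ ?_
    · rw [hn.left 0 r (by lia), zero_add]
    · rw [hn.left 0 (r + 1) (by lia), zero_add]
  have expand := lie_scomm_of_quadDefect (s := rootSign p j j)
    (S.quadDefect_current_pos_of_ne hp hij (r + 1) (m + 1))
    (S.quadDefect_current_pos_of_ne hp hij r (m + 1)) (neg (r + 1) (by lia)) (neg r (by lia))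
  have fold : ∀ a b, scomm (rootSign p j j) (x 1 j a) (x (-1) j b) = crossComm p x j a b :=
    fun _ _ => rfl
  simp only [fold, zero_add] at expand
  have last : ⁅current p x i r, crossComm p x j (m + 2) 1⁆ =
      ⁅current p x i r, current p x j (m + 3)⁆ := by
    rcases r with _ | r
    · rw [S.current_zero, S.lie_h₀_crossComm, S.lie_h₀_current]
    · rw [hn.right _ _ (by lia)]
  rw [hn.right (m + 1) 0 (by lia), hn.right (m + 2) 0 (by lia), hn.right (m + 1) 1 (by lia), last,
    hn.comm r (m + 1) (by lia), smul_zero, add_zero, sub_self, scomm_zero, smul_zero, add_zero,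
    lie_add, ← two_smul ℤ] at expand
  simpa only [add_zero] using expand

lemma lie_current_antidiagonal (S : CurrentSystem lam p h₀ h₁ x) (hp : IsSeparated p)
    (hij : i ≠ j) {n : ℕ} (hn : CollapsesUpTo p x i j n) {r m : ℕ} (hrm : r + m = n) :
    ⁅current p x i r, current p x j (m + 1)⁆ = (r : ℤ) • ⁅h₁ i, current p x j n⁆ := by
  induction r using Nat.twoStepInduction generalizing m with
  | zero => rw [S.current_zero, S.lie_h₀_current, Nat.cast_zero, zero_smul]
  | one => rw [S.current_one, Nat.cast_one, one_smul, add_comm m, hrm]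
  | more r ih₀ ih₁ =>
    rw [S.lie_current_recursion hp hij hn (by lia), ih₁ (m := m + 1) (by lia),
      ih₀ (m := m + 2) (by lia)]
    push_cast
    module

/-- Both ends of the arithmetic progression compute the same commutator, so that its common
difference is multiplied by `n²`. -/
lemma lie_h₁_current_of_collapsesUpTo (S : CurrentSystem lam p h₀ h₁ x) (hp : IsSeparated p)
    (hij : i ≠ j) {n : ℕ} (hn0 : n ≠ 0) (hn : CollapsesUpTo p x i j n) :
    ⁅h₁ i, current p x j n⁆ = 0 := by
  rcases eq_or_ne n 1 with rfl | hn1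
  · rw [S.current_one, S.lie_h₁_h₁]
  have hi := S.lie_current_antidiagonal hp hij hn (r := n) (m := 0) (by lia)
  have hj := S.lie_current_antidiagonal hp hij.symm hn.symm (r := n) (m := 0) (by lia)
  rw [zero_add, S.current_one, ← lie_skew] at hi hj
  have hne : (n : ℤ) * n - 1 ≠ 0 := by
    have : (2 : ℤ) ≤ n := by lia
    nlinarith
  refine (smul_eq_zero_iff_right hne).1 ?_
  linear_combination (norm := module) hj - (n : ℤ) • hi

lemma collapse_succ (S : CurrentSystem lam p h₀ h₁ x) (hki : cartan p k i ≠ 0) {n : ℕ}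
    (hn : ∀ a b, a + b ≤ n → crossComm p x i a b = current p x i (a + b))
    (h : ⁅h₁ k, current p x i n⁆ = 0) (a b : ℕ) (hab : a + b ≤ n + 1) :
    crossComm p x i a b = current p x i (a + b) := by
  rcases hab.lt_or_eq with hab | hab
  · exact hn a b (by lia)
  induction b generalizing a with
  | zero => rfl
  | succ b ih =>
    have e := S.lie_h₁_crossComm k i a b
    rw [hn a b (by lia), show a + b = n by lia, h, eq_comm, smul_eq_zero_iff_right hki,
      sub_eq_zero] at e
    rw [← e, ih (a + 1) (by lia) (by lia), Nat.succ_add_eq_add_succ]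

lemma collapsesUpTo (S : CurrentSystem lam p h₀ h₁ x) (hp : IsSeparated p) (hij : i ≠ j)
    (hc : cartan p i j ≠ 0) (n : ℕ) : CollapsesUpTo p x i j (n + 1) := by
  have comm_zero : ∀ i j r, ⁅current p x i 0, current p x j r⁆ = 0 := fun i j r => by
    rw [S.current_zero, S.lie_h₀_current]
  induction n with
  | zero =>
    have one : ∀ i a b, a + b ≤ 1 → crossComm p x i a b = current p x i (a + b) := by
      rintro i a (_ | b) hab
      · rfl
      · obtain ⟨rfl, rfl⟩ : a = 0 ∧ b = 0 := by lia
        exact (S.scomm_zero_one i).trans (S.current_one i).symm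
    refine ⟨one i, one j, fun r s hrs => ?_⟩
    rcases r with _ | r
    · exact comm_zero i j s
    · obtain rfl : s = 0 := by lia
      rw [← lie_skew, comm_zero, neg_zero]
  | succ n ih =>
    have hi := S.lie_h₁_current_of_collapsesUpTo hp hij n.succ_ne_zero ih
    have hj := S.lie_h₁_current_of_collapsesUpTo hp hij.symm n.succ_ne_zero ih.symm
    refine ⟨S.collapse_succ (cartan_comm i j ▸ hc) ih.left hj, S.collapse_succ hc ih.right hi,
      fun r s hrs => ?_⟩
    rcases s with _ | s
    · rw [← lie_skew, comm_zero, neg_zero]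
    rcases hrs.lt_or_eq with hrs | hrs
    · exact ih.comm r (s + 1) (by lia)
    · rw [S.lie_current_antidiagonal hp hij ih (by lia), hi, smul_zero]

lemma crossComm_eq_current (S : CurrentSystem lam p h₀ h₁ x) (hp : IsSeparated p) (i : Fin N)
    (a b : ℕ) : crossComm p x i a b = current p x i (a + b) := by
  obtain ⟨k, hki, hc⟩ := hp.exists_joined i
  exact (S.collapsesUpTo hp hki hc (a + b)).right a b (by lia)

lemma actsAsShift_current (S : CurrentSystem lam p h₀ h₁ x) (hp : IsSeparated p) (k i : Fin N) :
    ActsAsShift (h₁ k - lam • h₀ k ^ 2) 1 0 (0 : R) (current p x i) :=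
  actsAsShift_of_lie_eq_zero fun r => by
    rw [current, S.lie_shift_crossComm, S.crossComm_eq_current hp, S.crossComm_eq_current hp,
      add_right_comm, add_assoc, sub_self, smul_zero]

lemma lie_h₁_current (S : CurrentSystem lam p h₀ h₁ x) (hp : IsSeparated p) (k i : Fin N)
    (r : ℕ) : ⁅h₁ k, current p x i r⁆ = 0 := by
  rw [current, S.lie_h₁_crossComm, S.crossComm_eq_current hp, S.crossComm_eq_current hp,
    add_right_comm, add_assoc, sub_self, smul_zero]

lemma quadDefect_current_of_ne (S : CurrentSystem lam p h₀ h₁ x) (hp : IsSeparated p)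
    (hij : i ≠ j) (ε : ℤˣ) (r s : ℕ) :
    quadDefect (((ε : ℤ) * cartan p i j) • lam) 1 (current p x i) (x ε j) r s = 0 := by
  rcases Int.units_eq_one_or ε with rfl | rfl
  · simpa using S.quadDefect_current_pos_of_ne hp hij r s
  · have h : crossComm p x i 0 = current p x i := funext fun r => by
      rw [S.crossComm_eq_current hp, zero_add]
    simpa [h] using S.quadDefect_crossComm_neg_of_ne hp hij r s

lemma eq_zero_of_symmetric (S : CurrentSystem lam p h₀ h₁ x) (hp : IsSeparated p) {ε : ℤˣ}
    {P : ℕ → ℕ → A} (hsymm : ∀ r s, P r s = P s r)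
    (hP : ∀ H m a (b : R), ActsAsShift H m a b (x ε i) → ActsAsShift₂ H m a a (b + b) P)
    (h0 : P 0 0 = 0) (r s : ℕ) : P r s = 0 := by
  obtain ⟨k, hki, hc⟩ := hp.exists_joined i
  obtain ⟨U, hU⟩ := S.exists_double_shift k
  have hεc := units_mul_ne_zero ε hc
  have h₁ := hP _ _ _ _ (S.actsAsShift ε k i)
  have h₂ := hP _ _ _ _ (hU i (fun ε r => S.quadDefect_current_of_ne hp hki ε 1 r) ε)
  exact symmetric_family_eq_zero hsymm h0 (fun _ _ => h₁.add_apply_eq_zero hεc)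
    (fun _ _ => h₂.add_apply_eq_zero (mul_ne_zero three_ne_zero hεc)) r s

lemma quadDefect_eq_zero_of_even (S : CurrentSystem lam p h₀ h₁ x) (hp : IsSeparated p)
    (hi : rootParity p i = 0) (ε : ℤˣ) (r s : ℕ) :
    quadDefect (((ε : ℤ) * cartan p i i) • lam) 1 (x ε i) (x ε i) r s = 0 := by
  refine S.eq_zero_of_symmetric hp (i := i) (ε := ε) (fun r s => ?_)
    (fun _ _ _ _ h => h.quadDefect h _ _) ?_ r s
  · simp only [quadDefect, scomm]
    module
  · rw [← rootSign_self_of_even hi]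
    exact S.quadDefect_zero ε i i (by simp [hi])

lemma scomm_self_eq_zero_of_odd (S : CurrentSystem lam p h₀ h₁ x) (hp : IsSeparated p)
    (hi : rootParity p i = 1) (ε : ℤˣ) (r s : ℕ) : scomm (-1) (x ε i r) (x ε i s) = 0 := by
  refine S.eq_zero_of_symmetric hp (i := i) (ε := ε)
    (P := fun r s => scomm (-1) (x ε i r) (x ε i s)) (fun r s => ?_)
    (fun _ _ _ _ h => h.scomm h _) ?_ r s
  · rw [scomm_swap (.inr rfl), neg_neg, one_smul]
  · have h := S.scomm_of_cartan_eq_zero ε i i (cartan_self_of_odd hi)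
    rwa [rootSign_self_of_odd hi] at h

lemma exists_current_eq_scomm (S : CurrentSystem lam p h₀ h₁ x) (hp : IsSeparated p) (ε : ℤˣ)
    (i : Fin N) : ∃ y : A, ∀ r, current p x i r = scomm (rootSign p i i) (x ε i r) y := by
  rcases Int.units_eq_one_or ε with rfl | rfl
  · exact ⟨_, fun r => rfl⟩
  · refine ⟨-rootSign p i i • x 1 i 0, fun r => ?_⟩
    rw [← zero_add r, ← S.crossComm_eq_current hp, zero_add, crossComm,
      scomm_swap (rootSign_eq_one_or i i), scomm_smul]

lemma quadDefect_current_of_even (S : CurrentSystem lam p h₀ h₁ x) (hp : IsSeparated p)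
    (hi : rootParity p i = 0) (ε : ℤˣ) (r s : ℕ) :
    quadDefect (((ε : ℤ) * cartan p i i) • lam) 1 (current p x i) (x ε i) r s = 0 := by
  obtain ⟨k, -, hc⟩ := hp.exists_joined i
  obtain ⟨y, hy⟩ := S.exists_current_eq_scomm hp ε i
  simp only [rootSign_self_of_even hi, scomm_one] at hy
  have hP := (S.actsAsShift_current hp k i).quadDefect (S.actsAsShift ε k i)
    (((ε : ℤ) * cartan p i i) • lam) 1
  refine (hP.snd r).eq_zero (units_mul_ne_zero ε hc) ?_ s
  rw [quadDefect_swap hy (S.quadDefect_eq_zero_of_even hp hi ε r 0), S.quadDefect_current_zero,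
    neg_zero]

lemma lie_current_of_odd (S : CurrentSystem lam p h₀ h₁ x) (hp : IsSeparated p)
    (hi : rootParity p i = 1) (ε : ℤˣ) (r s : ℕ) : ⁅current p x i r, x ε i s⁆ = 0 := by
  obtain ⟨k, -, hc⟩ := hp.exists_joined i
  obtain ⟨y, hy⟩ := S.exists_current_eq_scomm hp ε i
  simp only [rootSign_self_of_odd hi] at hy
  have hP := (S.actsAsShift_current hp k i).scomm (S.actsAsShift ε k i) 1
  rw [← scomm_one]
  refine (hP.snd r).eq_zero (units_mul_ne_zero ε hc) ?_ s
  rw [scomm_one, lie_swap_of_anticomm hy (S.scomm_self_eq_zero_of_odd hp hi ε r 0),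
    S.current_zero, S.lie_h₀, cartan_self_of_odd hi, mul_zero, zero_smul, neg_zero]

lemma quadDefect_current (S : CurrentSystem lam p h₀ h₁ x) (hp : IsSeparated p)
    (hij : ¬(i = j ∧ rootParity p i = 1)) (ε : ℤˣ) (r s : ℕ) :
    quadDefect (((ε : ℤ) * cartan p i j) • lam) 1 (current p x i) (x ε j) r s = 0 := by
  rcases eq_or_ne i j with rfl | hne
  · exact S.quadDefect_current_of_even hp (rootParity_eq_zero_of_ne_one fun h => hij ⟨rfl, h⟩) ε r s
  · exact S.quadDefect_current_of_ne hp hne ε r s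

lemma lie_current_current (S : CurrentSystem lam p h₀ h₁ x) (hp : IsSeparated p) (i j : Fin N)
    (r s : ℕ) : ⁅current p x i r, current p x j s⁆ = 0 := by
  by_cases hij : i = j ∧ rootParity p i = 1
  · obtain ⟨rfl, hi⟩ := hij
    rw [current.eq_1 p x i s, crossComm, lie_scomm, S.lie_current_of_odd hp hi,
      S.lie_current_of_odd hp hi, zero_scomm, scomm_zero, zero_add]
  induction r using Nat.twoStepInduction generalizing s with
  | zero => rw [S.current_zero, S.lie_h₀_current]
  | one => rw [S.current_one, S.lie_h₁_current hp]
  | more r ih₀ ih₁ =>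
    have pos := S.quadDefect_current hp hij 1
    have neg := S.quadDefect_current hp hij (-1)
    simp only [Units.val_one, Units.val_neg, one_mul, neg_one_mul, neg_smul] at pos neg
    have expand := lie_scomm_of_quadDefect (s := rootSign p j j) (pos (r + 1) s) (pos r s)
      (neg (r + 1) 0) (neg r 0)
    have fold : ∀ a b, scomm (rootSign p j j) (x 1 j a) (x (-1) j b) = current p x j (a + b) :=
      S.crossComm_eq_current hp j
    simpa only [fold, lie_add, ih₀, ih₁, zero_add, add_zero, sub_self, scomm_zero, smul_zero]
      using expand

lemma serre_eq_zero (S : CurrentSystem lam p h₀ h₁ x) (hp : IsSeparated p) (hij : Neighbour i j)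
    (hi : rootParity p i = 0) (ε : ℤˣ) (r s t : ℕ) : serre (x ε i) (x ε j) r s t = 0 := by
  obtain ⟨H, d, hd, hHi, hHj⟩ := S.exists_isolating (hp.isolated_pair i j hij.ne)
  obtain ⟨H', d', hd', hHj', hHi'⟩ := S.exists_isolating (hp.isolated_pair j i hij.ne.symm)
  obtain ⟨U, hU⟩ := S.exists_double_shift i
  exact SuperYangian.serre_eq_zero (hHi ε) (hHj ε j rfl) (hHi' ε i rfl) (hHj' ε)
    (hU i (fun ε r => S.quadDefect_current_of_even hp hi ε 1 r) ε)
    (hU j (fun ε r => S.quadDefect_current_of_ne hp hij.ne ε 1 r) ε) (units_mul_ne_zero ε hd)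
    (units_mul_ne_zero ε hd')
    (mul_ne_zero three_ne_zero (units_mul_ne_zero ε (cartan_self_of_even hi)))
    (S.cubic ε i j hij hi) r s t

lemma quarticComm_eq_zero (S : CurrentSystem lam p h₀ h₁ x) (hp : IsSeparated p)
    (hij : (i : ℕ) + 1 = j) (hjk : (j : ℕ) + 1 = k) (hj : rootParity p j = 1) (ε : ℤˣ) (r s : ℕ) :
    quarticComm p i j k (x ε i r) (x ε j 0) (x ε k s) = 0 := by
  have hP : ∀ H a b, ActsAsShift H 1 a (0 : R) (x ε i) → ActsAsShift H 1 0 (0 : R) (x ε j) →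
      ActsAsShift H 1 b (0 : R) (x ε k) → ActsAsShift₂ H 1 a b (0 + 0 + (0 + 0) : R)
        fun r s => quarticComm p i j k (x ε i r) (x ε j 0) (x ε k s) := fun H a b hi hj hk =>
    ((hi.scomm hj _).fst 0).scomm ((hj.scomm hk _).snd 0) _
  obtain ⟨H, d, hd, hHi, hH⟩ := S.exists_isolating (hp.isolated_left i j k hij hjk)
  obtain ⟨H', d', hd', hHk', hH'⟩ := S.exists_isolating (hp.isolated_right i j k hij hjk)
  exact (hP H _ _ (hHi ε) (hH ε j (by simp)) (hH ε k (by simp))).eq_zero_of_isolating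
    (hP H' _ _ (hH' ε i (by simp)) (hH' ε j (by simp)) (hHk' ε)) (units_mul_ne_zero ε hd)
    (units_mul_ne_zero ε hd') (S.quartic ε i j k hij hjk hj) r s

end CurrentSystem

end Currents

section Relations

variable {R A : Type*} [CommRing R] [Ring A] [Algebra R A] {N : ℕ} {lam : R}
  {p : Fin (N + 1) → ZMod 2}

/-- The relations of the Drinfeld super Yangian, with parameter `λ = ħ/2`, between elements
`h_{i,r}` and `x^±_{i,r}` of an arbitrary algebra. -/
structure DrinfeldRelations (lam : R) (p : Fin (N + 1) → ZMod 2) (h : Fin N → ℕ → A)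
    (x : ℤˣ → Fin N → ℕ → A) : Prop where
  hh : ∀ i j r s, ⁅h i r, h j s⁆ = 0
  h0x : ∀ (ε : ℤˣ) i j s, ⁅h i 0, x ε j s⁆ = ((ε : ℤ) * cartan p i j) • x ε j s
  xx_same : ∀ i r s, scomm (rootSign p i i) (x 1 i r) (x (-1) i s) = h i (r + s)
  xx_ne : ∀ i j r s, i ≠ j → scomm (rootSign p i j) (x 1 i r) (x (-1) j s) = 0
  hx : ∀ (ε : ℤˣ) i j r s, ¬(i = j ∧ rootParity p i = 1) →
    quadDefect (((ε : ℤ) * cartan p i j) • lam) 1 (h i) (x ε j) r s = 0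
  xx : ∀ (ε : ℤˣ) i j r s, ¬(i = j ∧ rootParity p i = 1) →
    quadDefect (((ε : ℤ) * cartan p i j) • lam) (rootSign p i j) (x ε i) (x ε j) r s = 0
  hx_odd : ∀ (ε : ℤˣ) i r s, rootParity p i = 1 → ⁅h i r, x ε i s⁆ = 0
  xx_zero : ∀ (ε : ℤˣ) i j r s, cartan p i j = 0 → scomm (rootSign p i j) (x ε i r) (x ε j s) = 0
  cubic : ∀ (ε : ℤˣ) i j r s t, Neighbour i j → rootParity p i = 0 →
    serre (x ε i) (x ε j) r s t = 0
  quartic : ∀ (ε : ℤˣ) (i j k : Fin N) r s, (i : ℕ) + 1 = j → (j : ℕ) + 1 = k →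
    rootParity p j = 1 → quarticComm p i j k (x ε i r) (x ε j 0) (x ε k s) = 0

/-- The relations of the minimalistic presentation, with parameter `λ = ħ/2`, between elements
`h_{i,r}` and `x^±_{i,r}`, `r ∈ {0, 1}`, of an arbitrary algebra. -/
structure MinimalRelations (lam : R) (p : Fin (N + 1) → ZMod 2) (h : Fin N → Fin 2 → A)
    (x : ℤˣ → Fin N → Fin 2 → A) : Prop where
  hh : ∀ i j r s, ⁅h i r, h j s⁆ = 0
  h0x : ∀ (ε : ℤˣ) i j s, ⁅h i 0, x ε j s⁆ = ((ε : ℤ) * cartan p i j) • x ε j s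
  xx_same : ∀ i (r s t : Fin 2), (r : ℕ) + s = t →
    scomm (rootSign p i i) (x 1 i r) (x (-1) i s) = h i t
  xx_ne : ∀ i j (r s : Fin 2), (r : ℕ) + s ≤ 1 → i ≠ j →
    scomm (rootSign p i j) (x 1 i r) (x (-1) j s) = 0
  hx : ∀ (ε : ℤˣ) i j, ¬(i = j ∧ rootParity p i = 1) →
    ⁅h i 1 - lam • h i 0 ^ 2, x ε j 0⁆ = ((ε : ℤ) * cartan p i j) • x ε j 1
  xx : ∀ (ε : ℤˣ) i j, ¬(i = j ∧ rootParity p i = 1) →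
    scomm (rootSign p i j) (x ε i 1) (x ε j 0) - scomm (rootSign p i j) (x ε i 0) (x ε j 1) =
      ((ε : ℤ) * cartan p i j) • lam • scomm (-rootSign p i j) (x ε i 0) (x ε j 0)
  hx_odd : ∀ (ε : ℤˣ) i s, rootParity p i = 1 → ⁅h i 1, x ε i s⁆ = 0
  xx_zero : ∀ (ε : ℤˣ) i j, cartan p i j = 0 → scomm (rootSign p i j) (x ε i 0) (x ε j 0) = 0
  cubic : ∀ (ε : ℤˣ) i j, Neighbour i j → rootParity p i = 0 → ⁅x ε i 0, ⁅x ε i 0, x ε j 0⁆⁆ = 0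
  quartic : ∀ (ε : ℤˣ) (i j k : Fin N), (i : ℕ) + 1 = j → (j : ℕ) + 1 = k → rootParity p j = 1 →
    quarticComm p i j k (x ε i 0) (x ε j 0) (x ε k 0) = 0

namespace DrinfeldRelations

variable {h : Fin N → ℕ → A} {x : ℤˣ → Fin N → ℕ → A}

lemma lie_shift (D : DrinfeldRelations lam p h x) (ε : ℤˣ) {i j : Fin N}
    (hij : ¬(i = j ∧ rootParity p i = 1)) (r : ℕ) :
    ⁅h i 1 - lam • h i 0 ^ 2, x ε j r⁆ = ((ε : ℤ) * cartan p i j) • x ε j (r + 1) := by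
  rw [← sub_eq_zero, ← quadDefect_cartan_zero (D.h0x ε i j), D.hx ε i j 0 r hij]

lemma x_succ (D : DrinfeldRelations lam p h x) (ε : ℤˣ) {k i : Fin N} (hki : Neighbour k i)
    (r : ℕ) : x ε i (r + 1) = ((ε : ℤ) * cartan p k i) • ⁅h k 1 - lam • h k 0 ^ 2, x ε i r⁆ := by
  rw [D.lie_shift ε fun h => hki.ne h.1, smul_smul, hki.units_mul_cartan_mul_self, one_smul]

lemma minimalRelations [IsAddTorsionFree A] (D : DrinfeldRelations lam p h x) :
    MinimalRelations lam p (fun i (r : Fin 2) => h i r) (fun ε i (r : Fin 2) => x ε i r) where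
  hh i j r s := D.hh i j r s
  h0x ε i j s := D.h0x ε i j s
  xx_same i r s t hrs := by rw [D.xx_same, hrs]
  xx_ne i j r s _ hij := D.xx_ne i j r s hij
  hx ε i j hij := D.lie_shift ε hij 0
  xx ε i j hij := by
    rw [← sub_eq_zero, ← smul_assoc]
    exact D.xx ε i j 0 0 hij
  hx_odd ε i s hi := D.hx_odd ε i 1 s hi
  xx_zero ε i j hc := D.xx_zero ε i j 0 0 hc
  cubic ε i j hij hi := self_eq_neg.1 (eq_neg_of_add_eq_zero_left (D.cubic ε i j 0 0 0 hij hi))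
  quartic ε i j k := D.quartic ε i j k 0 0

lemma algHom_x_eq {B : Type*} [Ring B] [Algebra R B] (D : DrinfeldRelations lam p h x) (hN : N ≠ 1)
    {f g : A →ₐ[R] B} (hh : ∀ i (r : Fin 2), f (h i r) = g (h i r))
    (hx : ∀ ε i, f (x ε i 0) = g (x ε i 0)) (ε : ℤˣ) (i : Fin N) (r : ℕ) :
    f (x ε i r) = g (x ε i r) := by
  obtain ⟨k, hki⟩ := exists_neighbour hN i
  have h_zero : f (h k 0) = g (h k 0) := hh k 0
  have h_one : f (h k 1) = g (h k 1) := hh k 1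
  induction r with
  | zero => exact hx ε i
  | succ r ih =>
    simp only [D.x_succ ε hki, Ring.lie_def, map_zsmul, map_sub, map_mul, map_smul, map_pow,
      h_zero, h_one, ih]

lemma algHom_h_eq {B : Type*} [Ring B] [Algebra R B] (D : DrinfeldRelations lam p h x)
    {f g : A →ₐ[R] B} (hx : ∀ ε i r, f (x ε i r) = g (x ε i r)) (i : Fin N) (r : ℕ) :
    f (h i r) = g (h i r) := by
  have h_eq : h i r = scomm (rootSign p i i) (x 1 i r) (x (-1) i 0) := (D.xx_same i r 0).symm
  simp only [h_eq, scomm, map_sub, map_zsmul, map_mul, hx]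

end DrinfeldRelations

namespace MinimalRelations

variable {h : Fin N → Fin 2 → A} {x : ℤˣ → Fin N → Fin 2 → A}

lemma lie_h_tilde (M : MinimalRelations lam p h x) (i j : Fin N) (r : Fin 2) :
    ⁅h i r, h j 1 - lam • h j 0 ^ 2⁆ = 0 := by
  have commute : ∀ s, Commute (h i r) (h j s) := fun s => commute_iff_lie_eq.2 (M.hh i j r s)
  exact ((commute 1).sub_right (((commute 0).pow_right 2).smul_right lam)).lie_eq

lemma lie_tilde_tilde (M : MinimalRelations lam p h x) (i j : Fin N) :
    ⁅h i 1 - lam • h i 0 ^ 2, h j 1 - lam • h j 0 ^ 2⁆ = 0 := by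
  have commute : ∀ s, Commute (h i s) (h j 1 - lam • h j 0 ^ 2) := fun s =>
    commute_iff_lie_eq.2 (M.lie_h_tilde i j s)
  exact ((commute 1).sub_left (((commute 0).pow_left 2).smul_left lam)).lie_eq

lemma lie_tilde_x_zero (M : MinimalRelations lam p h x) (ε : ℤˣ) (i j : Fin N) :
    ⁅h i 1 - lam • h i 0 ^ 2, x ε j 0⁆ = ((ε : ℤ) * cartan p i j) • x ε j 1 := by
  by_cases hij : i = j ∧ rootParity p i = 1
  · obtain ⟨rfl, hi⟩ := hij
    have commute_one : Commute (h i 1) (x ε i 0) := commute_iff_lie_eq.2 (M.hx_odd ε i 0 hi)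
    have commute_zero : Commute (h i 0) (x ε i 0) := commute_iff_lie_eq.2 <| by
      rw [M.h0x, cartan_self_of_odd hi, mul_zero, zero_smul]
    rw [cartan_self_of_odd hi, mul_zero, zero_smul]
    exact (commute_one.sub_left ((commute_zero.pow_left 2).smul_left lam)).lie_eq
  · exact M.hx ε i j hij

/-- The elements `x^±_{i,r}` of all levels, obtained from level `0` by repeated commutators with
`h_{k,1} - λ h_{k,0}^2`, where `k = nb i` is to be a neighbour of `i`. The factor `±c_{ki}` is its
own inverse. -/
def levels (lam : R) (p : Fin (N + 1) → ZMod 2) (nb : Fin N → Fin N) (h : Fin N → Fin 2 → A)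
    (x : ℤˣ → Fin N → Fin 2 → A) (ε : ℤˣ) (i : Fin N) : ℕ → A
  | 0 => x ε i 0
  | r + 1 => ((ε : ℤ) * cartan p (nb i) i) •
      ⁅h (nb i) 1 - lam • h (nb i) 0 ^ 2, levels lam p nb h x ε i r⁆

variable {nb : Fin N → Fin N}

lemma levels_one (M : MinimalRelations lam p h x) (hnb : ∀ i, Neighbour (nb i) i) (ε : ℤˣ)
    (i : Fin N) : levels lam p nb h x ε i 1 = x ε i 1 := by
  rw [levels, levels, M.lie_tilde_x_zero, smul_smul, (hnb i).units_mul_cartan_mul_self, one_smul]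

lemma lie_h_zero_levels (M : MinimalRelations lam p h x) (ε : ℤˣ) (i j : Fin N) (r : ℕ) :
    ⁅h i 0, levels lam p nb h x ε j r⁆ =
      ((ε : ℤ) * cartan p i j) • levels lam p nb h x ε j r := by
  induction r with
  | zero => exact M.h0x ε i j 0
  | succ r ih => rw [levels, lie_smul, leibniz_lie, M.lie_h_tilde, zero_lie, zero_add, ih, lie_smul,
      smul_comm]

lemma lie_tilde_levels (M : MinimalRelations lam p h x) (hnb : ∀ i, Neighbour (nb i) i) (ε : ℤˣ)
    (i j : Fin N) (r : ℕ) : ⁅h i 1 - lam • h i 0 ^ 2, levels lam p nb h x ε j r⁆ =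
      ((ε : ℤ) * cartan p i j) • levels lam p nb h x ε j (r + 1) := by
  induction r with
  | zero => rw [M.levels_one hnb, levels, M.lie_tilde_x_zero]
  | succ r ih =>
    rw [levels, lie_smul, leibniz_lie, M.lie_tilde_tilde, zero_lie, zero_add, ih, lie_smul,
      smul_comm, ← levels]

lemma currentSystem_levels (M : MinimalRelations lam p h x) (hnb : ∀ i, Neighbour (nb i) i) :
    CurrentSystem lam p (h · 0) (h · 1) (levels lam p nb h x) where
  lie_h₁_h₁ i j := M.hh i j 1 1
  lie_h₀ := M.lie_h_zero_levels
  lie_shift := M.lie_tilde_levels hnb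
  scomm_zero_zero i := M.xx_same i 0 0 0 rfl
  scomm_one_zero i := by rw [M.levels_one hnb]; exact M.xx_same i 1 0 1 rfl
  scomm_zero_one i := by rw [M.levels_one hnb]; exact M.xx_same i 0 1 1 rfl
  scomm_of_ne i j hij := M.xx_ne i j 0 0 zero_le_one hij
  quadDefect_zero ε i j hij := by
    rw [quadDefect, zero_add, M.levels_one hnb, M.levels_one hnb, sub_eq_zero, smul_assoc]
    exact M.xx ε i j hij
  scomm_of_cartan_eq_zero := M.xx_zero
  cubic := M.cubic
  quartic := M.quartic

end MinimalRelations

lemma CurrentSystem.drinfeldRelations [IsAddTorsionFree A] {h₀ h₁ : Fin N → A}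
    {x : ℤˣ → Fin N → ℕ → A} (S : CurrentSystem lam p h₀ h₁ x) (hp : IsSeparated p) :
    DrinfeldRelations lam p (current p x) x where
  hh := S.lie_current_current hp
  h0x ε i j s := by rw [S.current_zero, S.lie_h₀]
  xx_same := S.crossComm_eq_current hp
  xx_ne i j r s hij := S.scomm_pos_neg_eq_zero hp hij r s
  hx ε i j r s hij := S.quadDefect_current hp hij ε r s
  xx ε i j r s hij := by
    by_cases h : i = j
    · subst h
      have hi := rootParity_eq_zero_of_ne_one fun hi => hij ⟨rfl, hi⟩
      rw [rootSign_self_of_even hi]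
      exact S.quadDefect_eq_zero_of_even hp hi ε r s
    · exact S.quadDefect_eq_zero_of_ne hp h ε r s
  hx_odd ε i r s hi := S.lie_current_of_odd hp hi ε r s
  xx_zero ε i j r s hc := by
    by_cases h : i = j
    · subst h
      have hi : rootParity p i = 1 := by
        by_contra hi
        exact cartan_self_of_even (rootParity_eq_zero_of_ne_one hi) hc
      rw [rootSign_self_of_odd hi]
      exact S.scomm_self_eq_zero_of_odd hp hi ε r s
    · exact S.scomm_eq_zero_of_ne hp h hc ε r s
  cubic ε i j r s t hij hi := S.serre_eq_zero hp hij hi ε r s t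
  quartic ε i j k r s hij hjk hj := S.quarticComm_eq_zero hp hij hjk hj ε r s

lemma MinimalRelations.exists_drinfeldRelations [IsAddTorsionFree A] {h : Fin N → Fin 2 → A}
    {x : ℤˣ → Fin N → Fin 2 → A} (M : MinimalRelations lam p h x) (hN : N ≠ 1)
    (hS : N = 3 → superdim p ≠ 0) :
    ∃ (h' : Fin N → ℕ → A) (x' : ℤˣ → Fin N → ℕ → A), DrinfeldRelations lam p h' x' ∧
      (∀ i (r : Fin 2), h' i r = h i r) ∧ ∀ ε i (r : Fin 2), x' ε i r = x ε i r := by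
  choose nb hnb using exists_neighbour hN
  have S := M.currentSystem_levels hnb
  refine ⟨_, _, S.drinfeldRelations (isSeparated hN hS), fun i r => ?_, fun ε i r => ?_⟩
  · fin_cases r
    exacts [S.current_zero i, S.current_one i]
  · fin_cases r
    exacts [rfl, M.levels_one hnb ε i]

end Relations

section Presentations

variable {𝕜 : Type*} [Field 𝕜] {N : ℕ} {p : Fin (N + 1) → ZMod 2}
  {A : Type*} [Ring A] [Algebra (PowerSeries 𝕜) A]

variable (𝕜) in
lemma isAddTorsionFree_of_algebra [CharZero 𝕜] (A : Type*) [Ring A] [Algebra (PowerSeries 𝕜) A] :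
    IsAddTorsionFree A := by
  let _ : Algebra 𝕜 A := Algebra.compHom A (PowerSeries.C (R := 𝕜))
  let _ : Algebra ℚ A := Algebra.compHom A (algebraMap ℚ 𝕜)
  exact IsAddTorsionFree.of_module_rat A

section FreeAlgebra

variable {L : Type}

variable (F : FreeAlgebra (PowerSeries 𝕜) (Gen N L) →ₐ[PowerSeries 𝕜] A)

lemma map_comm_val (u v : Elt 𝕜 p L) :
    F (u.comm v).val = scomm (sgn (u.deg * v.deg)) (F u.val) (F v.val) := by
  simp only [Homog.comm, scomm, map_sub, map_zsmul, map_mul]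

lemma map_anti_val (u v : Elt 𝕜 p L) :
    F (u.anti v).val = scomm (-sgn (u.deg * v.deg)) (F u.val) (F v.val) := by
  simp only [Homog.anti, scomm, map_add, map_zsmul, map_mul, neg_smul, sub_neg_eq_add]

lemma map_comm_val_of_deg_eq_zero {u : Elt 𝕜 p L} (hu : u.deg = 0) (v : Elt 𝕜 p L) :
    F (u.comm v).val = ⁅F u.val, F v.val⁆ := by
  rw [map_comm_val, hu, zero_mul, sgn, if_pos rfl, scomm_one]

lemma map_comm_fh (i : Fin N) (r : L) (v : Elt 𝕜 p L) :
    F ((fh 𝕜 p i r).comm v).val = ⁅F (fh 𝕜 p i r).val, F v.val⁆ :=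
  map_comm_val_of_deg_eq_zero F rfl v

lemma map_anti_fh (i : Fin N) (r : L) (v : Elt 𝕜 p L) :
    F ((fh 𝕜 p i r).anti v).val = scomm (-1) (F (fh 𝕜 p i r).val) (F v.val) := by
  rw [map_anti_val, show (fh 𝕜 p i r).deg = 0 from rfl, zero_mul, sgn, if_pos rfl]

lemma map_comm_fx_fx (ε ε' : ℤˣ) (i j : Fin N) (r s : L) :
    F ((fx 𝕜 p ε i r).comm (fx 𝕜 p ε' j s)).val =
      scomm (rootSign p i j) (F (fx 𝕜 p ε i r).val) (F (fx 𝕜 p ε' j s).val) :=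
  map_comm_val F _ _

lemma map_anti_fx_fx (ε ε' : ℤˣ) (i j : Fin N) (r s : L) :
    F ((fx 𝕜 p ε i r).anti (fx 𝕜 p ε' j s)).val =
      scomm (-rootSign p i j) (F (fx 𝕜 p ε i r).val) (F (fx 𝕜 p ε' j s).val) :=
  map_anti_val F _ _

lemma map_comm_comm {i : Fin N} (hi : rootParity p i = 0) (ε : ℤˣ) (j : Fin N) (r s t : L) :
    F ((fx 𝕜 p ε i r).comm ((fx 𝕜 p ε i s).comm (fx 𝕜 p ε j t))).val =
      ⁅F (fx 𝕜 p ε i r).val, ⁅F (fx 𝕜 p ε i s).val, F (fx 𝕜 p ε j t).val⁆⁆ := by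
  rw [map_comm_val_of_deg_eq_zero F hi, map_comm_val_of_deg_eq_zero F hi]

lemma map_quartic (ε : ℤˣ) (i j k : Fin N) (r s t : L) :
    F (((fx 𝕜 p ε i r).comm (fx 𝕜 p ε j s)).comm ((fx 𝕜 p ε j s).comm (fx 𝕜 p ε k t))).val =
      quarticComm p i j k (F (fx 𝕜 p ε i r).val) (F (fx 𝕜 p ε j s).val)
        (F (fx 𝕜 p ε k t).val) := by
  rw [map_comm_val, map_comm_fx_fx, map_comm_fx_fx]
  rfl

lemma map_comm_hTilde (F : FreeAlgebra (PowerSeries 𝕜) (Gen N (Fin 2)) →ₐ[PowerSeries 𝕜] A)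
    (i : Fin N) (v : Elt 𝕜 p (Fin 2)) : F ((hTilde 𝕜 p i).comm v).val =
      ⁅F (fh 𝕜 p i 1).val - halfHbar 𝕜 • F (fh 𝕜 p i 0).val ^ 2, F v.val⁆ := by
  rw [map_comm_val_of_deg_eq_zero F rfl, hTilde, map_sub, map_smul, map_pow]

end FreeAlgebra

lemma drinfeldRelations_of_map_eq
    {F : FreeAlgebra (PowerSeries 𝕜) (Gen N ℕ) →ₐ[PowerSeries 𝕜] A}
    (hF : ∀ a b, YangianRel 𝕜 p a b → F a = F b) :
    DrinfeldRelations (halfHbar 𝕜) p (fun i r => F (fh 𝕜 p i r).val)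
      (fun ε i r => F (fx 𝕜 p ε i r).val) where
  hh i j r s := by simpa only [map_comm_fh, map_zero] using hF _ _ (.hh i j r s)
  h0x ε i j s := by simpa only [map_comm_fh, map_zsmul] using hF _ _ (.h0x ε i j s)
  xx_same i r s := by simpa only [map_comm_fx_fx] using hF _ _ (.xx_same i r s)
  xx_ne i j r s hij := by simpa only [map_comm_fx_fx, map_zero] using hF _ _ (.xx_ne i j r s hij)
  hx ε i j r s hij := by
    simpa only [map_sub, map_comm_fh, map_anti_fh, map_zsmul, map_smul, quadDefect,
        scomm_one, sub_eq_zero, smul_assoc]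
      using hF _ _ (.hx ε i j r s hij)
  xx ε i j r s hij := by
    simpa only [map_sub, map_comm_fx_fx, map_anti_fx_fx, map_zsmul, map_smul,
        quadDefect, sub_eq_zero, smul_assoc]
      using hF _ _ (.xx ε i j r s hij)
  hx_odd ε i r s hi := by simpa only [map_comm_fh, map_zero] using hF _ _ (.hx_odd ε i r s hi)
  xx_zero ε i j r s hij := by
    simpa only [map_comm_fx_fx, map_zero] using hF _ _ (.xx_zero ε i j r s hij)
  cubic ε i j r s t hij hi := by
    simpa only [map_add, map_comm_comm F hi, map_zero, serre]
      using hF _ _ (.cubic ε i j r s t hij hi)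
  quartic ε i j k r s hij hjk hj := by
    simpa only [map_quartic, map_zero] using hF _ _ (.quartic ε i j k r s hij hjk hj)

lemma DrinfeldRelations.map_eq
    {F : FreeAlgebra (PowerSeries 𝕜) (Gen N ℕ) →ₐ[PowerSeries 𝕜] A}
    (D : DrinfeldRelations (halfHbar 𝕜) p (fun i r => F (fh 𝕜 p i r).val)
      (fun ε i r => F (fx 𝕜 p ε i r).val)) {a b} (hab : YangianRel 𝕜 p a b) : F a = F b := by
  cases hab with
  | hh i j r s => simpa only [map_comm_fh, map_zero] using D.hh i j r s
  | h0x ε i j s => simpa only [map_comm_fh, map_zsmul] using D.h0x ε i j s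
  | xx_same i r s => simpa only [map_comm_fx_fx] using D.xx_same i r s
  | xx_ne i j r s hij => simpa only [map_comm_fx_fx, map_zero] using D.xx_ne i j r s hij
  | hx ε i j r s hij =>
    simpa only [map_sub, map_comm_fh, map_anti_fh, map_zsmul, map_smul, quadDefect,
        scomm_one, sub_eq_zero, smul_assoc]
      using D.hx ε i j r s hij
  | xx ε i j r s hij =>
    simpa only [map_sub, map_comm_fx_fx, map_anti_fx_fx, map_zsmul, map_smul,
        quadDefect, sub_eq_zero, smul_assoc]
      using D.xx ε i j r s hij
  | hx_odd ε i r s hi => simpa only [map_comm_fh, map_zero] using D.hx_odd ε i r s hi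
  | xx_zero ε i j r s hij => simpa only [map_comm_fx_fx, map_zero] using D.xx_zero ε i j r s hij
  | cubic ε i j r s t hij hi =>
    simpa only [map_add, map_comm_comm F hi, map_zero, serre] using D.cubic ε i j r s t hij hi
  | quartic ε i j k r s hij hjk hj =>
    simpa only [map_quartic, map_zero] using D.quartic ε i j k r s hij hjk hj

lemma minimalRelations_of_map_eq
    {F : FreeAlgebra (PowerSeries 𝕜) (Gen N (Fin 2)) →ₐ[PowerSeries 𝕜] A}
    (hF : ∀ a b, MinimalRel 𝕜 p a b → F a = F b) :
    MinimalRelations (halfHbar 𝕜) p (fun i r => F (fh 𝕜 p i r).val)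
      (fun ε i r => F (fx 𝕜 p ε i r).val) where
  hh i j r s := by simpa only [map_comm_fh, map_zero] using hF _ _ (.hh i j r s)
  h0x ε i j s := by simpa only [map_comm_fh, map_zsmul] using hF _ _ (.h0x ε i j s)
  xx_same i r s t hrs := by simpa only [map_comm_fx_fx] using hF _ _ (.xx_same i r s t hrs)
  xx_ne i j r s hrs hij := by
    simpa only [map_comm_fx_fx, map_zero] using hF _ _ (.xx_ne i j r s hrs hij)
  hx ε i j hij := by simpa only [map_comm_hTilde, map_zsmul] using hF _ _ (.hx ε i j hij)
  xx ε i j hij := by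
    simpa only [map_sub, map_comm_fx_fx, map_anti_fx_fx, map_zsmul, map_smul]
      using hF _ _ (.xx ε i j hij)
  hx_odd ε i s hi := by simpa only [map_comm_fh, map_zero] using hF _ _ (.hx_odd ε i s hi)
  xx_zero ε i j hij := by simpa only [map_comm_fx_fx, map_zero] using hF _ _ (.xx_zero ε i j hij)
  cubic ε i j hij hi := by
    simpa only [map_comm_comm F hi, map_zero] using hF _ _ (.cubic ε i j hij hi)
  quartic ε i j k hij hjk hj := by
    simpa only [map_quartic, map_zero] using hF _ _ (.quartic ε i j k hij hjk hj)

lemma MinimalRelations.map_eq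
    {F : FreeAlgebra (PowerSeries 𝕜) (Gen N (Fin 2)) →ₐ[PowerSeries 𝕜] A}
    (M : MinimalRelations (halfHbar 𝕜) p (fun i r => F (fh 𝕜 p i r).val)
      (fun ε i r => F (fx 𝕜 p ε i r).val)) {a b} (hab : MinimalRel 𝕜 p a b) : F a = F b := by
  cases hab with
  | hh i j r s => simpa only [map_comm_fh, map_zero] using M.hh i j r s
  | h0x ε i j s => simpa only [map_comm_fh, map_zsmul] using M.h0x ε i j s
  | xx_same i r s t hrs => simpa only [map_comm_fx_fx] using M.xx_same i r s t hrs
  | xx_ne i j r s hrs hij => simpa only [map_comm_fx_fx, map_zero] using M.xx_ne i j r s hrs hij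
  | hx ε i j hij => simpa only [map_comm_hTilde, map_zsmul] using M.hx ε i j hij
  | xx ε i j hij =>
    simpa only [map_sub, map_comm_fx_fx, map_anti_fx_fx, map_zsmul, map_smul] using M.xx ε i j hij
  | hx_odd ε i s hi => simpa only [map_comm_fh, map_zero] using M.hx_odd ε i s hi
  | xx_zero ε i j hij => simpa only [map_comm_fx_fx, map_zero] using M.xx_zero ε i j hij
  | cubic ε i j hij hi => simpa only [map_comm_comm F hi, map_zero] using M.cubic ε i j hij hi
  | quartic ε i j k hij hjk hj =>
    simpa only [map_quartic, map_zero] using M.quartic ε i j k hij hjk hj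

end Presentations

section UniversalProperty

variable {𝕜 : Type*} [Field 𝕜] {N : ℕ} {p : Fin (N + 1) → ZMod 2}
  {A : Type*} [Ring A] [Algebra (PowerSeries 𝕜) A]

namespace Yangian

lemma drinfeldRelations :
    DrinfeldRelations (halfHbar 𝕜) p (Yangian.h 𝕜 p) (Yangian.x 𝕜 p) :=
  drinfeldRelations_of_map_eq (𝕜 := 𝕜) (A := Yangian 𝕜 p) fun _ _ hab =>
    RingQuot.mkAlgHom_rel (PowerSeries 𝕜) hab

variable {h : Fin N → ℕ → A} {x : ℤˣ → Fin N → ℕ → A}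

lemma exists_algHom (D : DrinfeldRelations (halfHbar 𝕜) p h x) :
    ∃ f : Yangian 𝕜 p →ₐ[PowerSeries 𝕜] A,
      (∀ i r, f (Yangian.h 𝕜 p i r) = h i r) ∧ ∀ ε i r, f (Yangian.x 𝕜 p ε i r) = x ε i r := by
  let F : FreeAlgebra (PowerSeries 𝕜) (Gen N ℕ) →ₐ[PowerSeries 𝕜] A :=
    FreeAlgebra.lift _ fun | .h i r => h i r | .x ε i r => x ε i r
  have F_h : ∀ i r, F (fh 𝕜 p i r).val = h i r := fun _ _ => FreeAlgebra.lift_ι_apply _ _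
  have F_x : ∀ ε i r, F (fx 𝕜 p ε i r).val = x ε i r := fun _ _ _ => FreeAlgebra.lift_ι_apply _ _
  have hF : ∀ ⦃a b⦄, YangianRel 𝕜 p a b → F a = F b := fun a b =>
    DrinfeldRelations.map_eq (by simpa only [F_h, F_x] using D)
  exact ⟨RingQuot.liftAlgHom _ ⟨F, hF⟩,
    fun i r => (RingQuot.liftAlgHom_mkAlgHom_apply ..).trans (F_h i r),
    fun ε i r => (RingQuot.liftAlgHom_mkAlgHom_apply ..).trans (F_x ε i r)⟩

lemma algHom_ext (hN : N ≠ 1) {f g : Yangian 𝕜 p →ₐ[PowerSeries 𝕜] A}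
    (hh : ∀ i (r : Fin 2), f (Yangian.h 𝕜 p i r) = g (Yangian.h 𝕜 p i r))
    (hx : ∀ ε i, f (Yangian.x 𝕜 p ε i 0) = g (Yangian.x 𝕜 p ε i 0)) : f = g := by
  have D := drinfeldRelations (𝕜 := 𝕜) (p := p)
  have x_eq := DrinfeldRelations.algHom_x_eq (A := Yangian 𝕜 p) D hN hh hx
  refine RingQuot.ringQuot_ext' _ _ _ (FreeAlgebra.hom_ext (funext fun u => ?_))
  cases u with
  | h i r => exact DrinfeldRelations.algHom_h_eq (A := Yangian 𝕜 p) D x_eq i r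
  | x ε i r => exact x_eq ε i r

lemma h_mem_parityPart (i : Fin N) (r : ℕ) : Yangian.h 𝕜 p i r ∈ parityPart 𝕜 p 0 :=
  Submodule.mem_map_of_mem (f := (RingQuot.mkAlgHom _ (YangianRel 𝕜 p)).toLinearMap)
    (fh 𝕜 p i r).mem

lemma x_mem_parityPart (ε : ℤˣ) (i : Fin N) (r : ℕ) :
    Yangian.x 𝕜 p ε i r ∈ parityPart 𝕜 p (rootParity p i) :=
  Submodule.mem_map_of_mem (f := (RingQuot.mkAlgHom _ (YangianRel 𝕜 p)).toLinearMap)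
    (fx 𝕜 p ε i r).mem

end Yangian

namespace MinimalYangian

lemma minimalRelations :
    MinimalRelations (halfHbar 𝕜) p (MinimalYangian.h 𝕜 p) (MinimalYangian.x 𝕜 p) :=
  minimalRelations_of_map_eq (𝕜 := 𝕜) (A := MinimalYangian 𝕜 p) fun _ _ hab =>
    RingQuot.mkAlgHom_rel (PowerSeries 𝕜) hab

lemma exists_algHom {h : Fin N → Fin 2 → A} {x : ℤˣ → Fin N → Fin 2 → A}
    (M : MinimalRelations (halfHbar 𝕜) p h x) :
    ∃ f : MinimalYangian 𝕜 p →ₐ[PowerSeries 𝕜] A,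
      (∀ i r, f (MinimalYangian.h 𝕜 p i r) = h i r) ∧
        ∀ ε i r, f (MinimalYangian.x 𝕜 p ε i r) = x ε i r := by
  let F : FreeAlgebra (PowerSeries 𝕜) (Gen N (Fin 2)) →ₐ[PowerSeries 𝕜] A :=
    FreeAlgebra.lift _ fun | .h i r => h i r | .x ε i r => x ε i r
  have F_h : ∀ i r, F (fh 𝕜 p i r).val = h i r := fun _ _ => FreeAlgebra.lift_ι_apply _ _
  have F_x : ∀ ε i r, F (fx 𝕜 p ε i r).val = x ε i r := fun _ _ _ => FreeAlgebra.lift_ι_apply _ _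
  have hF : ∀ ⦃a b⦄, MinimalRel 𝕜 p a b → F a = F b := fun a b =>
    MinimalRelations.map_eq (by simpa only [F_h, F_x] using M)
  exact ⟨RingQuot.liftAlgHom _ ⟨F, hF⟩,
    fun i r => (RingQuot.liftAlgHom_mkAlgHom_apply ..).trans (F_h i r),
    fun ε i r => (RingQuot.liftAlgHom_mkAlgHom_apply ..).trans (F_x ε i r)⟩

lemma algHom_ext {f g : MinimalYangian 𝕜 p →ₐ[PowerSeries 𝕜] A}
    (hh : ∀ i r, f (MinimalYangian.h 𝕜 p i r) = g (MinimalYangian.h 𝕜 p i r))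
    (hx : ∀ ε i r, f (MinimalYangian.x 𝕜 p ε i r) = g (MinimalYangian.x 𝕜 p ε i r)) : f = g := by
  refine RingQuot.ringQuot_ext' _ _ _ (FreeAlgebra.hom_ext (funext fun u => ?_))
  cases u with
  | h i r => exact hh i r
  | x ε i r => exact hx ε i r

end MinimalYangian

end UniversalProperty

section Grading

lemma map_eq_of_map_le_of_surjective {ι R A B : Type*} [DecidableEq ι] [AddMonoid ι]
    [CommSemiring R] [Semiring A] [Algebra R A] [Semiring B] [Algebra R B]
    {𝒜 : ι → Submodule R A} {ℬ : ι → Submodule R B} [GradedAlgebra 𝒜] [GradedAlgebra ℬ]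
    {f : A →ₐ[R] B} (hf : ∀ i, (𝒜 i).map f.toLinearMap ≤ ℬ i) (hs : Function.Surjective f)
    (i : ι) : (𝒜 i).map f.toLinearMap = ℬ i := by
  let F : 𝒜 →+*ᵍ ℬ := { f.toRingHom with
    map_mem := fun ha => hf _ (Submodule.mem_map_of_mem ha) }
  refine le_antisymm (hf i) fun b hb => ?_
  obtain ⟨a, rfl⟩ := hs b
  have component : f (DirectSum.decompose 𝒜 a i) = DirectSum.decompose ℬ (f a) i :=
    map_directSumDecompose 𝒜 ℬ F
  rw [DirectSum.decompose_of_mem_same ℬ hb] at component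
  exact ⟨_, SetLike.coe_mem _, component⟩

lemma map_grading_le {R G A : Type*} [CommRing R] [Semiring A] [Algebra R A] {par : G → ZMod 2}
    {rel : FreeAlgebra R G → FreeAlgebra R G → Prop} {ℬ : ZMod 2 → Submodule R A}
    [SetLike.GradedMonoid ℬ] {f : RingQuot rel →ₐ[R] A}
    (hf : ∀ g, f (RingQuot.mkAlgHom R rel (FreeAlgebra.ι R g)) ∈ ℬ (par g)) (a : ZMod 2) :
    (grading R par rel a).map f.toLinearMap ≤ ℬ a := by
  rw [grading, Submodule.map_le_iff_le_comap, Submodule.map_le_iff_le_comap, freeGrading,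
    Submodule.span_le]
  rintro _ ⟨letters, rfl, rfl⟩
  change f (RingQuot.mkAlgHom R rel _) ∈ ℬ _
  induction letters with
  | nil =>
    simp only [List.map_nil, List.prod_nil, List.sum_nil, map_one]
    exact SetLike.one_mem_graded ℬ
  | cons g letters ih =>
    simp only [List.map_cons, List.prod_cons, List.sum_cons, map_mul]
    exact SetLike.mul_mem_graded (hf g) ih

lemma map_parityPart_eq {𝕜 : Type*} [Field 𝕜] {N : ℕ} {p : Fin (N + 1) → ZMod 2}
    {f : MinimalYangian 𝕜 p →ₐ[PowerSeries 𝕜] Yangian 𝕜 p}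
    (f_h : ∀ i (r : Fin 2), f (MinimalYangian.h 𝕜 p i r) = Yangian.h 𝕜 p i r)
    (f_x : ∀ ε i (r : Fin 2), f (MinimalYangian.x 𝕜 p ε i r) = Yangian.x 𝕜 p ε i r)
    (hf : Function.Surjective f) (a : ZMod 2) :
    (MinimalYangian.parityPart 𝕜 p a).map f.toLinearMap = Yangian.parityPart 𝕜 p a := by
  have f_gen : ∀ g, f (RingQuot.mkAlgHom (PowerSeries 𝕜) _ (FreeAlgebra.ι _ g)) ∈
      Yangian.parityPart 𝕜 p (g.parity p) := by
    rintro (⟨i, r⟩ | ⟨ε, i, r⟩)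
    · exact (congrArg (· ∈ Yangian.parityPart 𝕜 p 0) (f_h i r)).mpr
        (Yangian.h_mem_parityPart i r)
    · exact (congrArg (· ∈ Yangian.parityPart 𝕜 p (rootParity p i)) (f_x ε i r)).mpr
        (Yangian.x_mem_parityPart ε i r)
  have f_le : ∀ a, (MinimalYangian.parityPart 𝕜 p a).map f.toLinearMap ≤
      Yangian.parityPart 𝕜 p a := map_grading_le f_gen
  exact map_eq_of_map_le_of_surjective (f := f) f_le hf a

end Grading

end SuperYangian


open SuperYangian in
theorem mainTheorem4_general (𝕜 : Type*) [Field 𝕜] [CharZero 𝕜] (N : ℕ) (hN1 : N ≠ 1)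
    (p : Fin (N + 1) → ZMod 2) (hS : N = 3 → superdim p ≠ 0) :
    ∃ e : MinimalYangian 𝕜 p ≃ₐ[PowerSeries 𝕜] Yangian 𝕜 p,
      (∀ a, (MinimalYangian.parityPart 𝕜 p a).map e.toLinearMap = Yangian.parityPart 𝕜 p a) ∧
      (∀ i (r : Fin 2), e (MinimalYangian.h 𝕜 p i r) = Yangian.h 𝕜 p i r) ∧
      ∀ ε i (r : Fin 2), e (MinimalYangian.x 𝕜 p ε i r) = Yangian.x 𝕜 p ε i r := by
  have := isAddTorsionFree_of_algebra 𝕜 (Yangian 𝕜 p)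
  have := isAddTorsionFree_of_algebra 𝕜 (MinimalYangian 𝕜 p)
  obtain ⟨φ, φ_h, φ_x⟩ := MinimalYangian.exists_algHom (𝕜 := 𝕜) (A := Yangian 𝕜 p)
    (Yangian.drinfeldRelations (p := p)).minimalRelations
  obtain ⟨h, x, D, h_eq, x_eq⟩ :=
    (MinimalYangian.minimalRelations (𝕜 := 𝕜) (p := p)).exists_drinfeldRelations hN1 hS
  obtain ⟨ψ, ψ_h, ψ_x⟩ := Yangian.exists_algHom (𝕜 := 𝕜) (A := MinimalYangian 𝕜 p) D
  have φψ : φ.comp ψ = AlgHom.id _ _ :=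
    Yangian.algHom_ext (𝕜 := 𝕜) (p := p) (A := Yangian 𝕜 p) hN1
      (fun i r => (congrArg φ ((ψ_h i r).trans (h_eq i r))).trans (φ_h i r))
      (fun ε i => (congrArg φ ((ψ_x ε i 0).trans (x_eq ε i 0))).trans (φ_x ε i 0))
  have ψφ : ψ.comp φ = AlgHom.id _ _ :=
    MinimalYangian.algHom_ext (𝕜 := 𝕜) (p := p) (A := MinimalYangian 𝕜 p)
      (fun i r => (congrArg ψ (φ_h i r)).trans ((ψ_h i r).trans (h_eq i r)))
      (fun ε i r => (congrArg ψ (φ_x ε i r)).trans ((ψ_x ε i r).trans (x_eq ε i r)))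
  let e := AlgEquiv.ofAlgHom φ ψ φψ ψφ
  exact ⟨e, map_parityPart_eq φ_h φ_x e.surjective, φ_h, φ_x⟩

theorem mainTheorem4 (𝕜 : Type*) [Field 𝕜] [IsAlgClosed 𝕜] [CharZero 𝕜]
    (N : ℕ) (hN : 1 ≤ N) (hN1 : N ≠ 1) (p : Fin (N + 1) → ZMod 2)
    (hN3 : N = 3 → ∀ i j : Fin N, (i : ℕ) = 0 → (j : ℕ) = 2 →
      SuperYangian.rootParity p i ≠ SuperYangian.rootParity p j)
    (hodd : ∀ i : Fin N, SuperYangian.rootParity p i = 1 →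
      ∃ j : Fin N, SuperYangian.Neighbour i j ∧ SuperYangian.rootParity p j = 0) :
    ∃ e : SuperYangian.MinimalYangian 𝕜 p ≃ₐ[PowerSeries 𝕜] SuperYangian.Yangian 𝕜 p,
      (∀ a : ZMod 2, (SuperYangian.MinimalYangian.parityPart 𝕜 p a).map e.toLinearMap =
        SuperYangian.Yangian.parityPart 𝕜 p a) ∧
      (∀ (i : Fin N) (r : Fin 2),
        e (SuperYangian.MinimalYangian.h 𝕜 p i r) = SuperYangian.Yangian.h 𝕜 p i r) ∧
      (∀ (ε : ℤˣ) (i : Fin N) (r : Fin 2),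
        e (SuperYangian.MinimalYangian.x 𝕜 p ε i r) = SuperYangian.Yangian.x 𝕜 p ε i r) := by
  refine mainTheorem4_general 𝕜 N hN1 p fun h => ?_
  subst h
  exact SuperYangian.superdim_ne_zero_of_rootParity_ne (hN3 rfl 0 2 rfl rfl)
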